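/- Let $c\in\mathbb{C}$, and let $f$ be a meromorphic function on $\mathbb{C}$ of finite order, i.e. $\limsup_{r\to\infty}\log^+T(r,f)/\log r<\infty$, such that $\Delta_c f\not\equiv 0$, where $\Delta_c f(z):=f(z+c)-f(z)$. Let $m(r,\cdot)$, $N(r,\cdot)$ and $T(r,\cdot)=m(r,\cdot)+N(r,\cdot)$ denote the Nevanlinna proximity function, the integrated counting function of poles (counted with multiplicity) and the characteristic function. A real function $\varphi$ of $r$ is said to be $S(r,f)$ if there is a set $E\subset(0,\infty)$ of finite logarithmic measure, $\int_E \frac{dr}{r}<\infty$, such that $\varphi(r)=o(T(r,f))$ as $r\to\infty$ with $r\notin E$; a meromorphic function $g$ on $\mathbb{C}$ belongs to $\mathcal{S}(f)$ if $T(r,g)=S(r,f)$. Let $q\ge 2$, and let $a_1,\dots,a_q$ be distinct meromorphic functions on $\mathbb{C}$, each periodic with period $c$ (that is, $a_k(z+c)\equiv a_k(z)$), such that $a_k\in\mathcal{S}(f)$ for all $k=1,\dots,q$. Then $$m(r,f)+\sum_{k=1}^q m\left(r,\frac{1}{f-a_k}\right)\le 2T(r,f)-N_{pair}(r,f)+S(r,f),$$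 where $$N_{pair}(r,f):=2N(r,f)-N(r,\Delta_c f)+N\left(r,\frac{1}{\Delta_c f}\right),$$ and the exceptional set associated with $S(r,f)$ is of at most finite logarithmic measure. -/

import Mathlib

open Filter Topology Asymptotics MeasureTheory

noncomputable section

namespace DifferenceNevanlinna

/-! Meromorphic functions on the plane are represented, as in Mathlib, by total functions
`ℂ → ℂ` satisfying `Meromorphic`. The values at the points of a closed discrete set (such as the
poles) carry no information, so identity of meromorphic functions is equality on a codiscrete
set. -/

/-- Identity `f ≡ g` of meromorphic functions in the plane. -/
def MerEq (f g : ℂ → ℂ) : Prop := f =ᶠ[codiscrete ℂ] g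

/-- The exact difference `Δ_c f (z) = f (z + c) - f z`. -/
def diff (c : ℂ) (f : ℂ → ℂ) : ℂ → ℂ := fun z ↦ f (z + c) - f z

/-- `a` is periodic with period `c`. -/
def PeriodicMer (c : ℂ) (a : ℂ → ℂ) : Prop := MerEq (fun z ↦ a (z + c)) a

/-- Nevanlinna proximity function `m(r, f)`. -/
abbrev m (r : ℝ) (f : ℂ → ℂ) : ℝ := ValueDistribution.proximity f ⊤ r

/-- Integrated counting function `N(r, f)` of the poles of `f`, counted with multiplicity. -/
abbrev N (r : ℝ) (f : ℂ → ℂ) : ℝ := ValueDistribution.logCounting f ⊤ r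

/-- Nevanlinna characteristic `T(r, f) = m(r, f) + N(r, f)`. -/
abbrev T (r : ℝ) (f : ℂ → ℂ) : ℝ := ValueDistribution.characteristic f ⊤ r

/-- The order of growth `limsup_{r → ∞} log⁺ T(r, f) / log r`, in the extended reals. -/
def order (f : ℂ → ℂ) : EReal :=
  limsup (fun r : ℝ ↦ ((Real.posLog (T r f) / Real.log r : ℝ) : EReal)) atTop

/-- `f` has finite order. -/
def FiniteOrder (f : ℂ → ℂ) : Prop := order f < ⊤

/-- `E ⊆ (0, ∞)` has finite logarithmic measure: `∫_E dr / r < ∞`. -/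
def FiniteLogMeasure (E : Set ℝ) : Prop :=
  MeasurableSet E ∧ E ⊆ Set.Ioi 0 ∧ ∫⁻ r in E, ENNReal.ofReal r⁻¹ < ⊤

/-- `φ(r) = S(r, f)`: `φ(r) = o(T(r, f))` as `r → ∞` outside of a set of finite logarithmic
measure. -/
def IsSmallError (f : ℂ → ℂ) (φ : ℝ → ℝ) : Prop :=
  ∃ E : Set ℝ, FiniteLogMeasure E ∧ φ =o[atTop ⊓ 𝓟 Eᶜ] (fun r ↦ T r f)

/-- The set `𝒮(f)` of meromorphic functions that are small compared to `f`. -/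
def smallFunctions (f : ℂ → ℂ) : Set (ℂ → ℂ) :=
  {g | Meromorphic g ∧ IsSmallError f (fun r ↦ T r g)}

/-- The pair term `N_pair(r, f) = 2 N(r, f) - N(r, Δ_c f) + N(r, 1 / Δ_c f)`. -/
def Npair (c : ℂ) (r : ℝ) (f : ℂ → ℂ) : ℝ :=
  2 * N r f - N r (diff c f) + N r (fun z ↦ 1 / diff c f z)

end DifferenceNevanlinna

end

namespace DifferenceNevanlinna

open Real Metric ValueDistribution MeromorphicOn

/-! The engine is the difference analogue of the lemma on the logarithmic derivative: if `g` is not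
identically zero and has polynomially bounded characteristic, then `m(r, g(z+c)/g(z)) = o(T(r,g) +
1)` off a set of finite logarithmic measure (`isLittleO_proximity_shift_div`). Since `a_k` has
period `c`, `Δ_c f / (f - a_k)` is the shift quotient of `f - a_k` minus 1, so its proximity
function is `S(r,f)`.

At a given point only the `a_k` nearest to `f` can make `1/(f - a_k)` large compared with the small
functions `2/(a_i - a_j)`. Hence a single copy of `m(r, 1/Δ_c f)` dominates the whole sum up to
`S(r,f)` (`sum_posLog_inv_sub_le`, `sum_proximity_inv_sub_le`). Jensen's formula turns `m(r, 1/Δ_c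
f)` into `m(r, Δ_c f) + N(r, Δ_c f) - N(r, 1/Δ_c f) + O(1)`, and `m(r, Δ_c f) ≤ m(r,f) + S(r,f)` is
the case of the periodic function 0. Adding `m(r,f)` gives `2T - N_pair`.

For the shift quotient (`proximity_shift_div_le`), the zeros and poles in a disk of radius `R > r +
|c|` are divided out. The zero-free factor is controlled by the Poisson formula; each zero or pole
contributes a logarithm whose circle average is small uniformly in its position. The number of these
points is bounded by `N` at a radius `R' > R`, and a Borel-type growth lemma brings `T(R')` back to
`T(r)` off a small set. -/

/-! ### Circle averages -/

/-- Monotonicity of circle averages for inequalities that hold off a discrete set. -/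
lemma circleAverage_mono_codiscreteWithin {φ ψ : ℂ → ℝ} {r : ℝ} (hr : r ≠ 0)
    (hφ : CircleIntegrable φ 0 r) (hψ : CircleIntegrable ψ 0 r)
    (h : ∀ᶠ z in codiscreteWithin (sphere (0 : ℂ) |r|), φ z ≤ ψ z) :
    circleAverage φ 0 r ≤ circleAverage ψ 0 r := by
  have h1 : φ =ᶠ[codiscreteWithin (sphere (0 : ℂ) |r|)] fun z ↦ min (φ z) (ψ z) := by
    filter_upwards [h] with z hz using (min_eq_left hz).symm
  rw [circleAverage_congr_codiscreteWithin h1 hr]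
  exact circleAverage_mono (hφ.congr_codiscreteWithin h1) hψ fun z _ ↦ min_le_right _ _

/-- With `α = 1 + h/r`, the right side minus `‖z - a‖²` equals `(α² - 1)(r² - ‖a‖²/α²) ≥ r²(α -
1/α)² ≥ h²`. Pulling `a` towards the origin thus absorbs `h²`, and the majorant has the form `log ‖z
- b‖`, whose circle average is known exactly. -/
lemma norm_sub_sq_add_sq_le {r h : ℝ} (hr : 0 < r) (hh : 0 < h) {a z : ℂ} (hz : ‖z‖ = r)
    (ha : ‖a‖ ≤ r) :
    ‖z - a‖ ^ 2 + h ^ 2 ≤ (1 + h / r) ^ 2 * ‖z - ((1 + h / r) ^ 2 : ℝ)⁻¹ • a‖ ^ 2 := by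
  set α : ℝ := 1 + h / r with hα
  have hα1 : 0 < α := by positivity
  have e1 : ‖z - a‖ ^ 2 = r ^ 2 - 2 * inner ℝ z a + ‖a‖ ^ 2 := by
    rw [@norm_sub_sq_real, hz]
  have e2 : ‖z - (α ^ 2 : ℝ)⁻¹ • a‖ ^ 2
      = r ^ 2 - 2 * ((α ^ 2)⁻¹ * inner ℝ z a) + ((α ^ 2)⁻¹ * ‖a‖) ^ 2 := by
    rw [@norm_sub_sq_real, hz, real_inner_smul_right, norm_smul, norm_inv, norm_pow,
      Real.norm_of_nonneg hα1.le]
  rw [e1, e2]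
  have e3 : α ^ 2 * (r ^ 2 - 2 * ((α ^ 2)⁻¹ * inner ℝ z a) + ((α ^ 2)⁻¹ * ‖a‖) ^ 2)
      = α ^ 2 * r ^ 2 - 2 * inner ℝ z a + ‖a‖ ^ 2 / α ^ 2 := by
    field_simp
  rw [e3]
  have e4 : α * r = r + h := by rw [hα]; field_simp
  have e5 : α ^ 2 * r ^ 2 = (r + h) ^ 2 := by rw [← e4]; ring
  have e6 : ‖a‖ ^ 2 / α ^ 2 ≥ ‖a‖ ^ 2 - 2 * r * h := by
    rw [ge_iff_le, le_div_iff₀ (by positivity)]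
    have h1 : α ^ 2 * r ^ 2 * ‖a‖ ^ 2 ≤ r ^ 2 * ‖a‖ ^ 2 + 2 * r * h * (α ^ 2 * r ^ 2) := by
      rw [e5]
      have : ‖a‖ ^ 2 ≤ r ^ 2 := by gcongr
      have : (2 * r * h + h ^ 2) * ‖a‖ ^ 2 ≤ (2 * r * h + h ^ 2) * r ^ 2 := by gcongr
      nlinarith [mul_pos hr hh, mul_pos (mul_pos hr hh) hh, mul_pos (mul_pos hr hr) hh,
        mul_pos (mul_pos (mul_pos hr hr) hh) hh, mul_pos (mul_pos (mul_pos hr hh) hh) hh]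
    have h2 : (‖a‖ ^ 2 - 2 * r * h) * α ^ 2 * r ^ 2 ≤ ‖a‖ ^ 2 * r ^ 2 := by nlinarith
    exact le_of_mul_le_mul_right h2 (by positivity)
  rw [e5]; nlinarith

/-- The previous estimate with `z` and `a` interchanged: a point outside the circle is pushed
outwards. -/
lemma norm_sub_sq_add_sq_le' {r h : ℝ} (hr : 0 < r) (hh : 0 < h) {a z : ℂ} (hz : ‖z‖ = r)
    (ha : r < ‖a‖) :
    ‖z - a‖ ^ 2 + h ^ 2
      ≤ ((1 + h / ‖a‖) ^ 2)⁻¹ * ‖z - ((1 + h / ‖a‖) ^ 2 : ℝ) • a‖ ^ 2 := by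
  have ha0 : 0 < ‖a‖ := hr.trans ha
  have key := norm_sub_sq_add_sq_le ha0 hh (a := z) (z := a) rfl (by rw [hz]; exact ha.le)
  set s : ℝ := (1 + h / ‖a‖) ^ 2 with hs
  have hs0 : 0 < s := by positivity
  rw [norm_sub_rev z a]
  refine key.trans (le_of_eq ?_)
  have : a - s⁻¹ • z = s⁻¹ • (s • a - z) := by
    rw [smul_sub, smul_smul, inv_mul_cancel₀ hs0.ne', one_smul]
  rw [this, norm_smul, norm_sub_rev z, norm_inv, Real.norm_of_nonneg hs0.le]
  field_simp

lemma circleIntegrable_log_norm_sq_add_sub {r h : ℝ} (hh : 0 < h) (a : ℂ) :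
    CircleIntegrable (fun z ↦ log (‖z - a‖ ^ 2 + h ^ 2) - 2 * log ‖z - a‖) 0 r := by
  have h1 : CircleIntegrable (fun z : ℂ ↦ log (‖z - a‖ ^ 2 + h ^ 2)) 0 r := by
    apply ContinuousOn.circleIntegrable'
    apply ContinuousOn.log (by fun_prop)
    intro x _
    positivity
  exact h1.sub ((circleIntegrable_log_norm_sub_const r).const_smul (a := (2 : ℝ)))

/-- The bound does not depend on `a`. After majorizing by `log s + 2 log ‖z - b‖`, Jensen's formula
leaves `log s + 2 log⁺(‖b‖/r) - 2 log⁺(‖a‖/r)`. This is at most `2 log(1 + h/r)` when `‖a‖ ≤ r` and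
equals `2 log(1 + h/‖a‖)` otherwise. -/
lemma circleAverage_log_norm_sq_add_sub_le {r h : ℝ} (hr : 0 < r) (hh : 0 < h) (a : ℂ) :
    circleAverage (fun z ↦ log (‖z - a‖ ^ 2 + h ^ 2) - 2 * log ‖z - a‖) 0 r ≤ 2 * (h / r) := by
  have hA : ∀ b : ℂ, CircleIntegrable (fun z : ℂ ↦ 2 * log ‖z - b‖) 0 r := fun b ↦
    (circleIntegrable_log_norm_sub_const r).const_smul (a := (2 : ℝ))
  have hAv : ∀ b : ℂ, circleAverage (fun z : ℂ ↦ 2 * log ‖z - b‖) 0 r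
      = 2 * (log r + log⁺ (r⁻¹ * ‖b‖)) := fun b ↦ by
    have := circleAverage_fun_smul (a := (2 : ℝ)) (f := fun z : ℂ ↦ log ‖z - b‖) (c := 0) (R := r)
    simp only [smul_eq_mul] at this
    rw [this, circleAverage_log_norm_sub_const_eq_log_radius_add_posLog hr.ne']
    simp
  have hgen : ∀ (s : ℝ) (b : ℂ), 0 < s →
      (∀ z : ℂ, ‖z‖ = r → ‖z - a‖ ^ 2 + h ^ 2 ≤ s * ‖z - b‖ ^ 2) →
      circleAverage (fun z ↦ log (‖z - a‖ ^ 2 + h ^ 2) - 2 * log ‖z - a‖) 0 r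
        ≤ log s + 2 * log⁺ (r⁻¹ * ‖b‖) - 2 * log⁺ (r⁻¹ * ‖a‖) := by
    intro s b hs hb
    have hB : CircleIntegrable (fun z : ℂ ↦ log s + 2 * log ‖z - b‖) 0 r :=
      (circleIntegrable_const (log s) 0 r).add (hA b)
    have h1 : circleAverage (fun z ↦ log (‖z - a‖ ^ 2 + h ^ 2) - 2 * log ‖z - a‖) 0 r
        ≤ circleAverage (fun z ↦ (log s + 2 * log ‖z - b‖) - 2 * log ‖z - a‖) 0 r := by
      refine circleAverage_mono (circleIntegrable_log_norm_sq_add_sub hh a)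
        (hB.sub (hA a)) fun z hz ↦ ?_
      have hz' : ‖z‖ = r := by simpa [abs_of_pos hr] using hz
      have h2 := hb z hz'
      have h3 : ‖z - b‖ ≠ 0 := by
        intro h0
        rw [h0] at h2
        have : 0 < ‖z - a‖ ^ 2 + h ^ 2 := by positivity
        simp at h2
        linarith
      have h4 : log (‖z - a‖ ^ 2 + h ^ 2) ≤ log s + 2 * log ‖z - b‖ := by
        calc log (‖z - a‖ ^ 2 + h ^ 2) ≤ log (s * ‖z - b‖ ^ 2) := log_le_log (by positivity) h2
          _ = log s + 2 * log ‖z - b‖ := by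
            rw [log_mul hs.ne' (by positivity), log_pow]; norm_num
      linarith
    rw [circleAverage_fun_sub hB (hA a),
      circleAverage_fun_add (circleIntegrable_const (log s) 0 r) (hA b), hAv, hAv,
      circleAverage_const] at h1
    linarith
  rcases le_or_gt ‖a‖ r with ha | ha
  · have h1 := hgen _ _ (by positivity) fun z hz ↦ norm_sub_sq_add_sq_le hr hh hz ha
    have h2 : log⁺ (r⁻¹ * ‖((1 + h / r) ^ 2 : ℝ)⁻¹ • a‖) = 0 := by
      rw [posLog_eq_zero_iff, abs_of_nonneg (by positivity), norm_smul, norm_inv, norm_pow,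
        Real.norm_of_nonneg (by positivity)]
      have : ((1 + h / r) ^ 2)⁻¹ ≤ 1 := by
        apply inv_le_one_of_one_le₀
        apply one_le_pow₀
        have : 0 < h / r := by positivity
        linarith
      calc r⁻¹ * (((1 + h / r) ^ 2)⁻¹ * ‖a‖) ≤ r⁻¹ * (1 * r) := by gcongr
        _ = 1 := by field_simp
    have h3 : log ((1 + h / r) ^ 2) ≤ 2 * (h / r) := by
      rw [log_pow]
      have := log_le_sub_one_of_pos (x := 1 + h / r) (by positivity)
      push_cast; linarith
    have h4 : 0 ≤ log⁺ (r⁻¹ * ‖a‖) := posLog_nonneg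
    linarith
  · have ha0 : 0 < ‖a‖ := hr.trans ha
    have h1 := hgen _ _ (by positivity) fun z hz ↦ norm_sub_sq_add_sq_le' hr hh hz ha
    set s : ℝ := 1 + h / ‖a‖ with hs
    have hs1 : 1 ≤ s := by
      have : 0 < h / ‖a‖ := by positivity
      linarith
    have hs0 : 0 < s := by linarith
    have h0 : 1 ≤ r⁻¹ * ‖a‖ := by rw [inv_mul_eq_div, one_le_div hr]; exact ha.le
    have h2 : log⁺ (r⁻¹ * ‖((s ^ 2 : ℝ)) • a‖) = 2 * log s + log (r⁻¹ * ‖a‖) := by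
      have e : r⁻¹ * ‖((s ^ 2 : ℝ)) • a‖ = s ^ 2 * (r⁻¹ * ‖a‖) := by
        rw [norm_smul, norm_pow, Real.norm_of_nonneg hs0.le]; ring
      rw [e, posLog_eq_log, log_mul (by positivity) (by positivity), log_pow]
      · norm_num
      · rw [abs_of_nonneg (by positivity)]
        exact one_le_mul_of_one_le_of_one_le (one_le_pow₀ hs1) h0
    have h3 : log⁺ (r⁻¹ * ‖a‖) = log (r⁻¹ * ‖a‖) := by
      rw [posLog_eq_log]; rwa [abs_of_nonneg (by positivity)]
    rw [h2, h3, log_inv, log_pow] at h1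
    have h4 : log s ≤ h / r := by
      have := log_le_sub_one_of_pos hs0
      have : h / ‖a‖ ≤ h / r := by gcongr
      linarith
    push_cast at h1
    linarith

/-- A bound for `log⁺ ‖(w + c) / w‖` whose circle average is under control. -/
lemma log_norm_add_sub_log_norm_le {c w : ℂ} {η h : ℝ} (hη : 0 < η) (h1 : 1 ≤ h)
    (hh : (1 + η⁻¹) * ‖c‖ ^ 2 ≤ h ^ 2) (hw : w ≠ 0) (hwc : w + c ≠ 0) :
    log ‖w + c‖ - log ‖w‖ ≤ (η + (log (‖w‖ ^ 2 + h ^ 2) - 2 * log ‖w‖)) / 2 := by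
  have hw' : 0 < ‖w‖ := norm_pos_iff.2 hw
  have hwc' : 0 < ‖w + c‖ := norm_pos_iff.2 hwc
  have e1 : ‖w + c‖ ^ 2 ≤ (1 + η) * (‖w‖ ^ 2 + h ^ 2) := by
    have h3 : ‖w + c‖ ^ 2 ≤ (‖w‖ + ‖c‖) ^ 2 := by gcongr; exact norm_add_le w c
    -- Weighted AM-GM: the cross term costs a factor `1 + η` on `‖w‖²`, and the remaining `(1 +
    -- η⁻¹)‖c‖²` goes into `h²`.
    have h4 : 2 * ‖w‖ * ‖c‖ ≤ η * ‖w‖ ^ 2 + η⁻¹ * ‖c‖ ^ 2 := by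
      have : 0 ≤ η⁻¹ * (η * ‖w‖ - ‖c‖) ^ 2 := by positivity
      have e : η⁻¹ * (η * ‖w‖ - ‖c‖) ^ 2 = η * ‖w‖ ^ 2 - 2 * ‖w‖ * ‖c‖ + η⁻¹ * ‖c‖ ^ 2 := by
        field_simp
        ring
      linarith
    have h5 : 0 ≤ η * h ^ 2 := by positivity
    nlinarith
  have e2 : 2 * log ‖w + c‖ ≤ log (1 + η) + log (‖w‖ ^ 2 + h ^ 2) := by
    rw [← log_mul (by positivity) (by positivity)]
    have := log_le_log (by positivity) e1
    rw [log_pow] at this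
    exact_mod_cast this
  have e3 : log (1 + η) ≤ η := by
    have := log_le_sub_one_of_pos (x := 1 + η) (by positivity)
    linarith
  linarith

/-- The condition `1 ≤ h` matters only at `w = 0`, where `log 0 = 0` by convention and `log (h²)`
remains. -/
lemma log_norm_sq_add_sub_nonneg {w : ℂ} {h : ℝ} (h1 : 1 ≤ h) :
    0 ≤ log (‖w‖ ^ 2 + h ^ 2) - 2 * log ‖w‖ := by
  by_cases hw : w = 0
  · simp only [hw, norm_zero]
    have : 0 ≤ log (h ^ 2) := log_nonneg (one_le_pow₀ h1)
    simpa using this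
  · have hw' : 0 < ‖w‖ := norm_pos_iff.2 hw
    have : log (‖w‖ ^ 2) ≤ log (‖w‖ ^ 2 + h ^ 2) :=
      log_le_log (by positivity) (by nlinarith [sq_nonneg h])
    rw [log_pow] at this
    push_cast at this
    linarith

/-- If `x ≤ M` and `M ≥ 0`, then `|x| ≤ 2M - x`. Here `M = log (2R)`, and the average of `log ‖z -
u‖` is nonnegative because `R ≥ 1`. -/
lemma circleAverage_abs_log_norm_sub_le {R : ℝ} (hR : 1 ≤ R) {u : ℂ} (hu : ‖u‖ ≤ R) :
    circleAverage (fun z ↦ |log ‖z - u‖|) 0 R ≤ 2 * log (2 * R) := by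
  have hi := circleIntegrable_log_norm_sub_const (a := u) (c := 0) R
  have h1 : circleAverage (fun z ↦ |log ‖z - u‖|) 0 R
      ≤ circleAverage (fun z ↦ 2 * log (2 * R) - log ‖z - u‖) 0 R := by
    refine circleAverage_mono hi.abs ((circleIntegrable_const _ 0 R).sub hi) fun z hz ↦ ?_
    have hz' : ‖z‖ = R := by simpa [abs_of_pos (by linarith : 0 < R)] using hz
    have h2 : log ‖z - u‖ ≤ log (2 * R) := by
      by_cases h0 : z - u = 0
      · simp only [h0, norm_zero, log_zero]; exact log_nonneg (by linarith)
      · apply log_le_log (norm_pos_iff.2 h0)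
        linarith [norm_sub_le z u]
    have h3 : 0 ≤ log (2 * R) := log_nonneg (by linarith)
    rcases abs_cases (log ‖z - u‖) with h | h <;> linarith
  rw [circleAverage_fun_sub (circleIntegrable_const _ 0 R) hi, circleAverage_const,
    circleAverage_log_norm_sub_const_eq_log_radius_add_posLog (by linarith)] at h1
  have h4 : 0 ≤ log⁺ (R⁻¹ * ‖0 - u‖) := posLog_nonneg
  have h5 : 0 ≤ log R := log_nonneg hR
  linarith

/-! ### The difference quotient in terms of zeros, poles and boundary values -/

lemma codiscreteWithin_add_const {P : ℂ → Prop} {U V : Set ℂ} {c : ℂ}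
    (hP : ∀ᶠ z in codiscreteWithin U, P z) (hV : ∀ z ∈ V, z + c ∈ U) :
    ∀ᶠ z in codiscreteWithin V, P (z + c) := by
  change {z | P z} ∈ codiscreteWithin U at hP
  change {z | P (z + c)} ∈ codiscreteWithin V
  rw [mem_codiscreteWithin_iff_forall_mem_nhdsNE] at hP ⊢
  intro x hx
  have ht : Tendsto (fun z : ℂ ↦ z + c) (𝓝[≠] x) (𝓝[≠] (x + c)) := by
    apply tendsto_nhdsWithin_of_tendsto_nhds_of_eventually_within
    · exact ((continuous_add_const c).tendsto x).mono_left nhdsWithin_le_nhds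
    · filter_upwards [self_mem_nhdsWithin] with z hz
      simpa using hz
  filter_upwards [ht.eventually (hP _ (hV x hx))] with z hz
  rcases hz with hz | hz
  · exact Or.inl hz
  · exact Or.inr fun hzV ↦ hz (hV z hzV)

lemma abs_re_herglotzRieszKernel_sub_le {R ρ : ℝ} (hρ : ρ < R) {w w' ζ : ℂ} (hζ : ‖ζ‖ = R)
    (hw : ‖w‖ ≤ ρ) (hw' : ‖w'‖ ≤ ρ) :
    |(herglotzRieszKernel 0 w' ζ).re - (herglotzRieszKernel 0 w ζ).re|
      ≤ 2 * ‖w' - w‖ * R / (R - ρ) ^ 2 := by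
  have h1 : R - ρ ≤ ‖ζ - w‖ := by linarith [norm_sub_norm_le ζ w]
  have h2 : R - ρ ≤ ‖ζ - w'‖ := by linarith [norm_sub_norm_le ζ w']
  have h3 : ζ - w ≠ 0 := norm_pos_iff.1 (by linarith)
  have h4 : ζ - w' ≠ 0 := norm_pos_iff.1 (by linarith)
  have e : herglotzRieszKernel 0 w' ζ - herglotzRieszKernel 0 w ζ
      = 2 * (w' - w) * ζ / ((ζ - w') * (ζ - w)) := by
    simp only [herglotzRieszKernel_def, sub_zero]
    field_simp
    ring
  rw [← Complex.sub_re, e]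
  refine (Complex.abs_re_le_norm _).trans ?_
  rw [norm_div, norm_mul, norm_mul, norm_mul, hζ, Complex.norm_two]
  have hR : 0 ≤ R := hζ ▸ norm_nonneg ζ
  gcongr
  rw [sq]
  exact mul_le_mul h2 h1 (by linarith) (norm_nonneg _)

/-- Continuity estimate inside a disk for the logarithm of a zero-free analytic function. -/
lemma log_norm_sub_log_norm_le {g : ℂ → ℂ} {R ρ : ℝ} (hR : 0 < R) (hρ : ρ < R)
    (hg : AnalyticOnNhd ℂ g (closedBall 0 R)) (hg0 : ∀ u ∈ closedBall (0 : ℂ) R, g u ≠ 0)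
    {w w' : ℂ} (hw : ‖w‖ ≤ ρ) (hw' : ‖w'‖ ≤ ρ) :
    log ‖g w'‖ - log ‖g w‖
      ≤ 2 * ‖w' - w‖ * R / (R - ρ) ^ 2 * circleAverage (fun z ↦ |log ‖g z‖|) 0 R := by
  have hharm : InnerProductSpace.HarmonicOnNhd (fun z ↦ log ‖g z‖) (closedBall 0 R) :=
    fun z hz ↦ (hg z hz).harmonicAt_log_norm (hg0 z hz)
  have hcont : ContinuousOn (fun z ↦ log ‖g z‖) (sphere (0 : ℂ) |R|) := by
    rw [abs_of_pos hR]
    exact hharm.continuousOn.mono sphere_subset_closedBall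
  have hwb : w ∈ ball (0 : ℂ) R := by simpa using hw.trans_lt hρ
  have hwb' : w' ∈ ball (0 : ℂ) R := by simpa using hw'.trans_lt hρ
  have hk : ∀ v ∈ ball (0 : ℂ) R,
      CircleIntegrable ((Complex.re ∘ herglotzRieszKernel 0 v) • fun z ↦ log ‖g z‖) 0 R := by
    intro v hv
    apply ContinuousOn.circleIntegrable'
    exact (Complex.continuous_re.comp_continuousOn
      (continuousOn_herglotzRieszKernel_sphere hv)).smul hcont
  -- The Poisson formula at both points: the difference of values is an integral of `log ‖g‖`
  -- against the difference of two kernels.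
  have e1 := hharm.circleAverage_re_herglotzRieszKernel_smul hwb
  have e2 := hharm.circleAverage_re_herglotzRieszKernel_smul hwb'
  rw [← e1, ← e2, ← circleAverage_sub (hk _ hwb') (hk _ hwb)]
  have hi : CircleIntegrable (fun z ↦ |log ‖g z‖|) 0 R := hcont.abs.circleIntegrable'
  have := circleAverage_fun_smul (a := 2 * ‖w' - w‖ * R / (R - ρ) ^ 2)
    (f := fun z : ℂ ↦ |log ‖g z‖|) (c := 0) (R := R)
  simp only [smul_eq_mul] at this
  rw [← this]
  refine circleAverage_mono ((hk _ hwb').sub (hk _ hwb)) (hi.const_smul (a := _)) fun z hz ↦ ?_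
  have hz' : ‖z‖ = R := by simpa [abs_of_pos hR] using hz
  have hb := abs_re_herglotzRieszKernel_sub_le hρ hz' hw hw'
  change (herglotzRieszKernel 0 w' z).re * log ‖g z‖ - (herglotzRieszKernel 0 w z).re * log ‖g z‖
    ≤ _
  rw [← sub_mul]
  refine (le_abs_self _).trans ?_
  rw [abs_mul]
  gcongr

lemma abs_log_eq_posLog_add_posLog_inv (x : ℝ) : |log x| = log⁺ x + log⁺ x⁻¹ := by
  rw [posLog_apply, posLog_apply, log_inv]
  rcases abs_cases (log x) with h | h
  · rw [max_eq_right h.2, max_eq_left (by linarith), h.1, add_zero]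
  · rw [max_eq_left h.2.le, max_eq_right (by linarith), h.1, zero_add]

/-- Number of zeros and poles of `f` in the closed disk of radius `R`, with multiplicity. -/
noncomputable def zeroPoleCount (f : ℂ → ℂ) (R : ℝ) : ℝ :=
  ∑ᶠ u, |(divisor f (closedBall 0 |R|) u : ℝ)|

theorem proximity_shift_div_le {f : ℂ → ℂ} (hf : Meromorphic f)
    (hf0 : ∀ z, meromorphicOrderAt f z ≠ ⊤) {c : ℂ} {r R η h : ℝ} (hr : 0 < r) (hR : 1 ≤ R)
    (hrR : r + ‖c‖ < R) (hη : 0 < η) (h1 : 1 ≤ h) (hh : (1 + η⁻¹) * ‖c‖ ^ 2 ≤ h ^ 2) :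
    proximity (fun z ↦ f (z + c) / f z) ⊤ r
      ≤ 2 * ‖c‖ * R / (R - (r + ‖c‖)) ^ 2 * (proximity f ⊤ R + proximity f⁻¹ ⊤ R
          + zeroPoleCount f R * (2 * log (2 * R)))
        + zeroPoleCount f R * (η + 2 * (h / r)) := by
  have hR0 : 0 < R := by linarith
  set U : Set ℂ := closedBall 0 |R| with hU
  have hU' : U = closedBall 0 R := by rw [hU, abs_of_pos hR0]
  set D := divisor f U with hD
  have hfin : D.support.Finite := D.finiteSupport (isCompact_closedBall 0 |R|)
  obtain ⟨g, hg, hg0, hfg⟩ := hf.meromorphicOn.extract_zeros_poles (U := U)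
    (fun u ↦ hf0 u) hfin
  have hlog := extract_zeros_poles_log hg0 hfg
  set s : Finset ℂ := hfin.toFinset with hs
  have hsupp : ∀ u, u ∉ s → D u = 0 := fun u hu ↦ by simpa [hs] using hu
  have hsU : ∀ u ∈ s, ‖u‖ ≤ R := fun u hu ↦ by
    have : u ∈ U := D.supportWithinDomain (by simpa [hs] using hu)
    simpa [hU'] using this
  have hn : zeroPoleCount f R = ∑ u ∈ s, |(D u : ℝ)| := by
    rw [zeroPoleCount]
    apply finsum_eq_sum_of_support_subset
    intro u hu
    by_contra hus
    have h0 : divisor f (closedBall 0 |R|) u = 0 := hsupp u hus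
    exact hu (by simp [h0])
  have hlog' : ∀ᶠ z in codiscreteWithin U,
      log ‖f z‖ = ∑ u ∈ s, D u * log ‖z - u‖ + log ‖g z‖ := by
    filter_upwards [hlog] with z hz
    rw [hz, Pi.add_apply, finsum_eq_sum_of_support_subset (s := s)]
    · simp [hD]
    · intro u hu
      by_contra hus
      have h0 : divisor f U u = 0 := hsupp u hus
      exact hu (by ext; simp [h0])
  have hgR : AnalyticOnNhd ℂ g (closedBall 0 R) := hU' ▸ hg
  have hgR0 : ∀ u ∈ closedBall (0 : ℂ) R, g u ≠ 0 := fun u hu ↦ hg0 ⟨u, hU' ▸ hu⟩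
  set B := circleAverage (fun z ↦ |log ‖g z‖|) 0 R with hB
  have hsphere : sphere (0 : ℂ) |R| ⊆ U := sphere_subset_closedBall
  -- boundary values of `log ‖g‖`
  have hB1 : B ≤ proximity f ⊤ R + proximity f⁻¹ ⊤ R + zeroPoleCount f R * (2 * log (2 * R)) := by
    have i1 : CircleIntegrable (fun z ↦ log⁺ ‖f z‖) 0 R :=
      hf.meromorphicOn.circleIntegrable_posLog_norm
    have i2 : CircleIntegrable (fun z ↦ log⁺ ‖f⁻¹ z‖) 0 R :=
      hf.inv.meromorphicOn.circleIntegrable_posLog_norm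
    have i3 : ∀ u ∈ s, CircleIntegrable (fun z ↦ |(D u : ℝ)| * |log ‖z - u‖|) 0 R := fun u _ ↦
      (circleIntegrable_log_norm_sub_const (a := u) (c := 0) R).abs.const_smul (a := |(D u : ℝ)|)
    have i4 : CircleIntegrable (fun z ↦ ∑ u ∈ s, |(D u : ℝ)| * |log ‖z - u‖|) 0 R :=
      CircleIntegrable.fun_sum s i3
    have i12 : CircleIntegrable (fun z ↦ log⁺ ‖f z‖ + log⁺ ‖f⁻¹ z‖) 0 R := i1.add i2
    have i0 : CircleIntegrable (fun z ↦ |log ‖g z‖|) 0 R :=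
      ((hgR.mono (by rw [abs_of_pos hR0]; exact sphere_subset_closedBall)).meromorphicOn.circleIntegrable_log_norm).abs
    have hle : B ≤ circleAverage (fun z ↦ (log⁺ ‖f z‖ + log⁺ ‖f⁻¹ z‖)
        + ∑ u ∈ s, |(D u : ℝ)| * |log ‖z - u‖|) 0 R := by
      refine circleAverage_mono_codiscreteWithin hR0.ne' i0 (i12.add i4) ?_
      filter_upwards [hlog'.filter_mono (codiscreteWithin_mono hsphere)] with z hz
      have e : log ‖g z‖ = log ‖f z‖ - ∑ u ∈ s, D u * log ‖z - u‖ := by linarith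
      rw [e]
      refine (abs_sub _ _).trans ?_
      rw [abs_log_eq_posLog_add_posLog_inv, Pi.inv_apply, norm_inv]
      gcongr
      refine (Finset.abs_sum_le_sum_abs _ _).trans (le_of_eq ?_)
      simp_rw [abs_mul]
    rw [circleAverage_fun_add i12 i4, circleAverage_fun_add i1 i2, circleAverage_fun_sum i3] at hle
    rw [proximity_top, proximity_top, hn, Finset.sum_mul]
    refine hle.trans ?_
    gcongr with u hu
    have := circleAverage_fun_smul (a := |(D u : ℝ)|)
      (f := fun z : ℂ ↦ |log ‖z - u‖|) (c := 0) (R := R)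
    simp only [smul_eq_mul] at this
    rw [this]
    gcongr
    exact circleAverage_abs_log_norm_sub_le hR (hsU u hu)
  set K : ℝ := 2 * ‖c‖ * R / (R - (r + ‖c‖)) ^ 2 with hK
  have hK0 : 0 ≤ K := by positivity
  set W : ℂ → ℂ → ℝ := fun a z ↦ log (‖z - a‖ ^ 2 + h ^ 2) - 2 * log ‖z - a‖ with hW
  have hW0 : ∀ a z, 0 ≤ W a z := fun a z ↦ log_norm_sq_add_sub_nonneg h1
  have hWi : ∀ a, CircleIntegrable (W a) 0 r := fun a ↦
    circleIntegrable_log_norm_sq_add_sub (by linarith) a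
  have hB0 : 0 ≤ B := circleAverage_nonneg_of_nonneg fun _ _ ↦ abs_nonneg _
  set V : Set ℂ := sphere 0 |r| with hV
  have hVr : ∀ z ∈ V, ‖z‖ = r := fun z hz ↦ by simpa [hV, abs_of_pos hr] using hz
  have hVU : V ⊆ U := fun z hz ↦ by
    rw [hU', mem_closedBall_zero_iff, hVr z hz]; linarith [norm_nonneg c]
  have hVcU : ∀ z ∈ V, z + c ∈ U := fun z hz ↦ by
    rw [hU', mem_closedBall_zero_iff]; linarith [norm_add_le z c, hVr z hz]
  have hDz := D.eq_zero_codiscreteWithin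
  have hpt : ∀ᶠ z in codiscreteWithin V, log⁺ ‖f (z + c) / f z‖
      ≤ K * B + ∑ u ∈ s, |(D u : ℝ)| * (η + (W u z + W (u - c) z) / 2) := by
    filter_upwards [hlog'.filter_mono (codiscreteWithin_mono hVU),
      codiscreteWithin_add_const hlog' hVcU, hDz.filter_mono (codiscreteWithin_mono hVU),
      codiscreteWithin_add_const hDz hVcU, self_mem_codiscreteWithin V] with z e1 e2 d1 d2 hz
    have hRHS : 0 ≤ K * B + ∑ u ∈ s, |(D u : ℝ)| * (η + (W u z + W (u - c) z) / 2) := by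
      have : ∀ u ∈ s, 0 ≤ |(D u : ℝ)| * (η + (W u z + W (u - c) z) / 2) := fun u _ ↦ by
        have := hW0 u z
        have := hW0 (u - c) z
        positivity
      have := Finset.sum_nonneg this
      positivity
    rw [posLog_apply]
    refine max_le hRHS ?_
    -- If either value vanishes, the quotient is 0 in Lean and its logarithm is 0, so nonnegativity
    -- of the right side suffices.
    by_cases hz1 : f z = 0
    · simpa [hz1] using hRHS
    by_cases hz2 : f (z + c) = 0
    · simpa [hz2] using hRHS
    rw [norm_div, log_div (by simpa using hz2) (by simpa using hz1), e1, e2]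
    have hgg : log ‖g (z + c)‖ - log ‖g z‖ ≤ K * B := by
      have := log_norm_sub_log_norm_le hR0 hrR hgR hgR0 (w := z) (w' := z + c)
        (by rw [hVr z hz]; linarith [norm_nonneg c]) (by linarith [norm_add_le z c, hVr z hz])
      simpa using this
    -- `D u` may have either sign, so the logarithm of the ratio is bounded on both sides. The shift
    -- by `c` from `z` gives `W u`; the shift by `-c` from `z + c` gives `W (u - c)`.
    have hterm : ∀ u ∈ s, D u * log ‖z + c - u‖ - D u * log ‖z - u‖
        ≤ |(D u : ℝ)| * (η + (W u z + W (u - c) z) / 2) := by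
      intro u hu
      have hDu : D u ≠ 0 := by simpa [hs] using hu
      have hzu : z - u ≠ 0 := fun h0 ↦ hDu (by rw [← sub_eq_zero.1 h0]; simpa using d1)
      have hzcu : z + c - u ≠ 0 := fun h0 ↦ hDu (by rw [← sub_eq_zero.1 h0]; simpa using d2)
      have b1 := log_norm_add_sub_log_norm_le hη h1 hh hzu
        (by rwa [show z - u + c = z + c - u by ring])
      have b2 := log_norm_add_sub_log_norm_le (c := -c) hη h1 (by simpa using hh) hzcu
        (by rwa [show z + c - u + -c = z - u by ring])
      rw [show z - u + c = z + c - u by ring] at b1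
      rw [show z + c - u + -c = z - u by ring] at b2
      have eW : W (u - c) z = log (‖z + c - u‖ ^ 2 + h ^ 2) - 2 * log ‖z + c - u‖ := by
        simp only [hW]
        rw [show z - (u - c) = z + c - u by ring]
      rw [← eW] at b2
      change _ ≤ (η + W u z) / 2 at b1
      have p1 := hW0 u z
      have p2 := hW0 (u - c) z
      rw [← mul_sub]
      refine (le_abs_self _).trans ?_
      rw [abs_mul]
      gcongr
      rw [abs_le]
      constructor <;> linarith
    have hsum := Finset.sum_le_sum hterm
    rw [Finset.sum_sub_distrib] at hsum
    linarith
  -- integrate over the circle of radius `r`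
  have hfc : Meromorphic fun z ↦ f (z + c) := fun z ↦
    (hf (z + c)).comp_analyticAt (g := fun z ↦ z + c) (by fun_prop)
  have j0 : CircleIntegrable (fun z ↦ log⁺ ‖f (z + c) / f z‖) 0 r :=
    (hfc.div hf).meromorphicOn.circleIntegrable_posLog_norm
  have j1 : ∀ u, CircleIntegrable (fun z ↦ η + (W u z + W (u - c) z) / 2) 0 r := fun u ↦ by
    have := (circleIntegrable_const η 0 r).add
      (((hWi u).add (hWi (u - c))).const_smul (a := (2 : ℝ)⁻¹))
    refine this.congr ?_
    intro z _
    simp [div_eq_inv_mul, mul_add]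
  have j2 : ∀ u ∈ s, CircleIntegrable (fun z ↦ |(D u : ℝ)| * (η + (W u z + W (u - c) z) / 2)) 0 r :=
    fun u _ ↦ (j1 u).const_smul (a := |(D u : ℝ)|)
  have j3 : CircleIntegrable
      (fun z ↦ ∑ u ∈ s, |(D u : ℝ)| * (η + (W u z + W (u - c) z) / 2)) 0 r :=
    CircleIntegrable.fun_sum s j2
  have hav : ∀ u, circleAverage (fun z ↦ η + (W u z + W (u - c) z) / 2) 0 r ≤ η + 2 * (h / r) := by
    intro u
    have k1 : CircleIntegrable (fun z ↦ W u z / 2) 0 r := by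
      simp only [div_eq_inv_mul]
      exact (hWi u).const_smul (a := (2 : ℝ)⁻¹)
    have k2 : CircleIntegrable (fun z ↦ W (u - c) z / 2) 0 r := by
      simp only [div_eq_inv_mul]
      exact (hWi (u - c)).const_smul (a := (2 : ℝ)⁻¹)
    have k12 : CircleIntegrable (fun z ↦ W u z / 2 + W (u - c) z / 2) 0 r := k1.add k2
    have kav : ∀ a, circleAverage (fun z ↦ W a z / 2) 0 r ≤ h / r := fun a ↦ by
      have := circleAverage_fun_smul (a := (2 : ℝ)⁻¹) (f := W a) (c := 0) (R := r)
      simp only [smul_eq_mul, ← div_eq_inv_mul] at this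
      rw [this]
      have := circleAverage_log_norm_sq_add_sub_le hr (by linarith : 0 < h) a
      simp only [hW]
      linarith
    simp_rw [add_div]
    rw [circleAverage_fun_add (circleIntegrable_const η 0 r) k12, circleAverage_const,
      circleAverage_fun_add k1 k2]
    linarith [kav u, kav (u - c)]
  have hfinal := circleAverage_mono_codiscreteWithin hr.ne' j0
    ((circleIntegrable_const (K * B) 0 r).add j3) hpt
  rw [circleAverage_add (circleIntegrable_const (K * B) 0 r) j3, circleAverage_const,
    circleAverage_fun_sum j2] at hfinal
  rw [proximity_top]
  refine hfinal.trans ?_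
  have hsum : ∑ u ∈ s, circleAverage (fun z ↦ |(D u : ℝ)| * (η + (W u z + W (u - c) z) / 2)) 0 r
      ≤ zeroPoleCount f R * (η + 2 * (h / r)) := by
    rw [hn, Finset.sum_mul]
    gcongr with u hu
    have := circleAverage_fun_smul (a := |(D u : ℝ)|)
      (f := fun z : ℂ ↦ η + (W u z + W (u - c) z) / 2) (c := 0) (R := r)
    simp only [smul_eq_mul] at this
    rw [this]
    gcongr
    exact hav u
  gcongr

/-! ### Counting zeros and poles -/

/-- Each point with `‖u‖ ≤ R` contributes `log R' - log ‖u‖ ≥ log (R'/R)` to the counting function.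
The origin contributes `log R'`, by `log 0 = 0`, which suffices since `R ≥ 1`. -/
lemma finsum_toClosedBall_mul_log_le_logCounting {E : Function.locallyFinsupp ℂ ℤ} (hE : 0 ≤ E)
    {R R' : ℝ} (hR : 1 ≤ R) (hRR' : R < R') :
    (∑ᶠ u, (E.toClosedBall R u : ℝ)) * log (R' / R) ≤ E.logCounting R' := by
  have hR0 : 0 < R := by linarith
  have hR'0 : 0 < R' := by linarith
  have hfin : ∀ ρ : ℝ, (E.toClosedBall ρ).support.Finite := fun ρ ↦
    (E.toClosedBall ρ).finiteSupport (isCompact_closedBall 0 |ρ|)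
  have e1 : E.logCounting R' = ∑ᶠ u, (E.toClosedBall R' u : ℝ) * (log R' - log ‖(0 : ℂ) - u‖) := by
    rw [countingFunction_finsum_eq_finsum_add hR'0.ne' (hfin R')]
    simp [Function.locallyFinsuppWithin.logCounting]
  rw [e1, finsum_mul]
  refine finsum_le_finsum' ((hfin R).subset ?_) ((hfin R').subset ?_) fun u ↦ ?_
  · intro u hu
    simp_all
  · intro u hu
    simp_all
  have hEu : (0 : ℝ) ≤ E u := by exact_mod_cast hE u
  have hnn : ∀ ρ : ℝ, ‖u‖ ≤ ρ → 1 ≤ ρ → 0 ≤ log ρ - log ‖u‖ := by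
    intro ρ h1 h2
    rcases eq_or_ne u 0 with rfl | hu
    · simpa using log_nonneg h2
    · exact sub_nonneg.2 (log_le_log (norm_pos_iff.2 hu) h1)
  rw [zero_sub, norm_neg]
  by_cases hu : ‖u‖ ≤ R
  · rw [Function.locallyFinsuppWithin.toClosedBall_eval_within _
        (by simpa [abs_of_pos hR0] using hu),
      Function.locallyFinsuppWithin.toClosedBall_eval_within _
        (by simpa [abs_of_pos hR'0] using hu.trans hRR'.le), log_div hR'0.ne' hR0.ne']
    have := hnn R hu hR
    exact mul_le_mul_of_nonneg_left (by linarith) hEu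
  · have h0 : E.toClosedBall R u = 0 :=
      (E.toClosedBall R).apply_eq_zero_of_notMem (by simpa [abs_of_pos hR0] using hu)
    rw [h0]
    by_cases hu' : ‖u‖ ≤ R'
    · rw [Function.locallyFinsuppWithin.toClosedBall_eval_within _
        (by simpa [abs_of_pos hR'0] using hu')]
      have := hnn R' hu' (by linarith)
      simpa using mul_nonneg hEu this
    · have h1 : E.toClosedBall R' u = 0 :=
        (E.toClosedBall R').apply_eq_zero_of_notMem (by simpa [abs_of_pos hR'0] using hu')
      simp [h1]

lemma zeroPoleCount_mul_log_le {f : ℂ → ℂ} (hf : Meromorphic f) {R R' : ℝ} (hR : 1 ≤ R)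
    (hRR' : R < R') :
    zeroPoleCount f R * log (R' / R) ≤ logCounting f ⊤ R' + logCounting f⁻¹ ⊤ R' := by
  set D := divisor f Set.univ with hD
  have hE : 0 ≤ D⁺ + D⁻ := add_nonneg (posPart_nonneg D) (negPart_nonneg D)
  have key := finsum_toClosedBall_mul_log_le_logCounting hE hR hRR'
  rw [map_add Function.locallyFinsuppWithin.logCounting, Pi.add_apply] at key
  rw [add_comm, logCounting_inv, logCounting_zero, logCounting_top]
  refine le_trans (le_of_eq ?_) key
  rw [zeroPoleCount]
  congr 1
  apply finsum_congr
  intro u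
  by_cases hu : u ∈ closedBall (0 : ℂ) |R|
  · rw [Function.locallyFinsuppWithin.toClosedBall_divisor hf,
      Function.locallyFinsuppWithin.toClosedBall_eval_within _ hu,
      Function.locallyFinsuppWithin.toClosedBall_eval_within _ hu]
    change |(D u : ℝ)| = (((D u)⁺ + (D u)⁻ : ℤ) : ℝ)
    rw [posPart_add_negPart]
    push_cast
    rfl
  · rw [Function.locallyFinsuppWithin.apply_eq_zero_of_notMem _ hu,
      Function.locallyFinsuppWithin.apply_eq_zero_of_notMem _ hu]
    simp

lemma zeroPoleCount_nonneg (f : ℂ → ℂ) (R : ℝ) : 0 ≤ zeroPoleCount f R :=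
  finsum_nonneg fun _ ↦ abs_nonneg _

/-! ### Sets of finite logarithmic measure and growth -/

lemma FiniteLogMeasure.union {E F : Set ℝ} (hE : FiniteLogMeasure E) (hF : FiniteLogMeasure F) :
    FiniteLogMeasure (E ∪ F) :=
  ⟨hE.1.union hF.1, Set.union_subset hE.2.1 hF.2.1,
    (lintegral_union_le _ _ _).trans_lt (ENNReal.add_lt_top.2 ⟨hE.2.2, hF.2.2⟩)⟩

lemma finiteLogMeasure_empty : FiniteLogMeasure ∅ := ⟨MeasurableSet.empty, by simp, by simp⟩

lemma lintegral_inv_Icc_le {i l : ℝ} (hi : 0 < i) :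
    ∫⁻ r in Set.Icc i (i + l), ENNReal.ofReal r⁻¹ ≤ ENNReal.ofReal (i⁻¹ * l) := by
  calc ∫⁻ r in Set.Icc i (i + l), ENNReal.ofReal r⁻¹
      ≤ ∫⁻ _ in Set.Icc i (i + l), ENNReal.ofReal i⁻¹ := by
        refine setLIntegral_mono measurable_const fun r hr ↦ ?_
        exact ENNReal.ofReal_le_ofReal (inv_anti₀ hi hr.1)
    _ = ENNReal.ofReal (i⁻¹ * l) := by
        rw [setLIntegral_const, Real.volume_Icc, add_sub_cancel_left,
          ENNReal.ofReal_mul (by positivity)]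

/-- A monotone function of polynomial growth at most doubles on the intervals
`[r, r + 2 r ^ (3/4)]`, off a set of `r` of finite logarithmic measure. -/
theorem exists_finiteLogMeasure_le_two_mul {τ : ℝ → ℝ} (hmono : MonotoneOn τ (Set.Ioi 0))
    (h1 : ∀ r, 1 ≤ r → 1 ≤ τ r) {A : ℝ} (hA : 0 < A) (hτ : ∀ᶠ r in atTop, τ r ≤ r ^ A) :
    ∃ E, FiniteLogMeasure E ∧
      ∀ᶠ r in atTop, r ∉ E → τ (r + 2 * r ^ (3 / 4 : ℝ)) ≤ 2 * τ r := by
  obtain ⟨r₁, hr₁⟩ := eventually_atTop.1 hτ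
  set r₀ := max r₁ 1 with hr₀
  have hr₀1 : 1 ≤ r₀ := le_max_right _ _
  set φ : ℝ → ℝ := fun s ↦ s + 2 * s ^ (3 / 4 : ℝ) with hφ
  have hφc : Continuous φ := by
    have := Real.continuous_rpow_const (q := (3 / 4 : ℝ)) (by norm_num)
    fun_prop
  -- Exceptional radii are sorted by the dyadic size of `τ`.
  set Bad : ℕ → Set ℝ := fun k ↦
    {r | r₀ ≤ r ∧ 2 ^ k ≤ τ r ∧ τ r < 2 ^ (k + 1) ∧ 2 * τ r < τ (φ r)} with hBad
  set b : ℝ := 2 ^ (A⁻¹) with hb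
  have hb1 : 1 < b := Real.one_lt_rpow (by norm_num) (by positivity)
  have hbdd : ∀ k, BddBelow (Bad k) := fun k ↦ ⟨r₀, fun r hr ↦ hr.1⟩
  have hlow : ∀ k, ∀ s ∈ Bad k, b ^ k ≤ s := by
    intro k s hs
    have hs1 : 1 ≤ s := hr₀1.trans hs.1
    have h2 : (2 : ℝ) ^ k ≤ s ^ A := hs.2.1.trans (hr₁ s ((le_max_left _ _).trans hs.1))
    have h3 : ((2 : ℝ) ^ k) ^ A⁻¹ ≤ (s ^ A) ^ A⁻¹ := by gcongr
    rw [Real.rpow_rpow_inv (by linarith) hA.ne'] at h3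
    refine le_trans (le_of_eq ?_) h3
    rw [hb, Real.rpow_pow_comm (by norm_num)]
  -- If `s ∈ Bad k` and `r > φ s`, then `τ r ≥ τ (φ s) > 2 τ s ≥ 2^(k+1)`, so `r ∉ Bad k`. The
  -- infimum need not lie in `Bad k`; it is approached by a sequence and `φ` is continuous.
  have hup : ∀ k, ∀ r ∈ Bad k, r ≤ φ (sInf (Bad k)) := by
    intro k r hr
    obtain ⟨u, -, hu, huB⟩ := exists_seq_tendsto_sInf ⟨r, hr⟩ (hbdd k)
    refine ge_of_tendsto ((hφc.tendsto _).comp hu) (Eventually.of_forall fun n ↦ ?_)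
    have hs := huB n
    by_contra hlt
    push Not at hlt
    have hs1 : 1 ≤ u n := hr₀1.trans hs.1
    have hφ0 : 0 < φ (u n) := by simp only [hφ]; positivity
    have hr0 : 0 < r := by linarith [hr.1]
    have := hmono (a := φ (u n)) hφ0 hr0 hlt.le
    have h4 := hs.2.2.2
    have h5 := hs.2.1
    have h6 := hr.2.2.1
    rw [pow_succ] at h6
    linarith
  set J : ℕ → Set ℝ := fun k ↦ {r | (Bad k).Nonempty ∧ r ∈ Set.Icc (sInf (Bad k)) (φ (sInf (Bad k)))}
    with hJ
  have hJcases : ∀ k, J k = ∅ ∨ ((Bad k).Nonempty ∧ J k = Set.Icc (sInf (Bad k)) (φ (sInf (Bad k)))) := by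
    intro k
    by_cases hk : (Bad k).Nonempty
    · exact Or.inr ⟨hk, by ext r; simp [hJ, hk]⟩
    · exact Or.inl (by simp [hJ, hk])
  have hinf : ∀ k, (Bad k).Nonempty → b ^ k ≤ sInf (Bad k) := fun k hk ↦
    le_csInf hk (hlow k)
  have hinf0 : ∀ k, (Bad k).Nonempty → 0 < sInf (Bad k) := fun k hk ↦
    lt_of_lt_of_le (by positivity) (hinf k hk)
  -- An interval `[i, i + 2 i^(3/4)]` has logarithmic measure at most `2 i^(-1/4)`. Polynomial
  -- growth forces `i ≥ b^k` on level `k`, so these measures are dominated by a geometric series.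
  set β : ℝ := b ^ (-(1 / 4) : ℝ) with hβ
  have hβ0 : 0 ≤ β := by positivity
  have hβ1 : β < 1 := Real.rpow_lt_one_of_one_lt_of_neg hb1 (by norm_num)
  have hint : ∀ k, ∫⁻ r in J k, ENNReal.ofReal r⁻¹ ≤ ENNReal.ofReal (2 * β ^ k) := by
    intro k
    rcases hJcases k with h | ⟨hk, h⟩
    · simp [h]
    · rw [h]
      have hi := hinf0 k hk
      refine (lintegral_inv_Icc_le hi).trans (ENNReal.ofReal_le_ofReal ?_)
      set i := sInf (Bad k)
      have e : i⁻¹ * (2 * i ^ (3 / 4 : ℝ)) = 2 * i ^ (-(1 / 4) : ℝ) := by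
        rw [← Real.rpow_neg_one, mul_left_comm, ← Real.rpow_add hi]
        norm_num
      have e2 : β ^ k = (b ^ k) ^ (-(1 / 4) : ℝ) := by
        rw [hβ, Real.rpow_pow_comm (by positivity)]
      rw [e, e2]
      gcongr 2 * ?_
      exact Real.rpow_le_rpow_of_nonpos (by positivity) (hinf k hk) (by norm_num)
  refine ⟨⋃ k, J k, ⟨?_, ?_, ?_⟩, ?_⟩
  · refine MeasurableSet.iUnion fun k ↦ ?_
    rcases hJcases k with h | ⟨-, h⟩ <;> rw [h]
    · exact MeasurableSet.empty
    · exact measurableSet_Icc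
  · refine Set.iUnion_subset fun k r hr ↦ ?_
    exact lt_of_lt_of_le (hinf0 k hr.1) hr.2.1
  · refine (lintegral_iUnion_le _ _).trans_lt ?_
    refine (ENNReal.tsum_le_tsum hint).trans_lt ?_
    exact ((summable_geometric_of_lt_one hβ0 hβ1).mul_left 2).tsum_ofReal_lt_top
  · filter_upwards [eventually_ge_atTop r₀] with r hr hrE
    by_contra hlt
    push Not at hlt
    obtain ⟨k, hk1, hk2⟩ := exists_nat_pow_near (h1 r (hr₀1.trans hr)) (one_lt_two)
    have hrB : r ∈ Bad k := ⟨hr, hk1, hk2, hlt⟩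
    exact hrE (Set.mem_iUnion.2 ⟨k, ⟨r, hrB⟩, csInf_le (hbdd k) hrB, hup k r hrB⟩)

/-! ### The difference analogue of the lemma on the logarithmic derivative -/

lemma characteristic_inv_le {f : ℂ → ℂ} (hf : Meromorphic f) {R : ℝ} (hR : R ≠ 0) :
    characteristic f⁻¹ ⊤ R
      ≤ characteristic f ⊤ R + |log ‖meromorphicTrailingCoeffAt f 0‖| := by
  have := characteristic_sub_characteristic_inv_of_ne_zero hf hR
  linarith [neg_abs_le (log ‖meromorphicTrailingCoeffAt f 0‖)]

lemma proximity_le_characteristic (f : ℂ → ℂ) {r : ℝ} (hr : 1 ≤ r) :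
    proximity f ⊤ r ≤ characteristic f ⊤ r := by
  have : 0 ≤ logCounting f ⊤ r := logCounting_nonneg hr
  simp only [characteristic, Pi.add_apply]
  linarith

lemma logCounting_le_characteristic (f : ℂ → ℂ) (r : ℝ) :
    logCounting f ⊤ r ≤ characteristic f ⊤ r := by
  have : 0 ≤ proximity f ⊤ r := proximity_nonneg r
  simp only [characteristic, Pi.add_apply]
  linarith

/-- The factor in the estimate of `m (r, f (z + c) / f)`, as a function of `r ^ (1/4)`. -/
noncomputable def shiftFactor (c : ℂ) (t : ℝ) : ℝ :=
  28 * ‖c‖ * (t⁻¹ * t⁻¹) + 96 * ‖c‖ * (log 4 * t⁻¹ + 4 * (log t / t)) + 3 * t⁻¹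
    + 6 * (t⁻¹ * t⁻¹ * t⁻¹)

lemma tendsto_shiftFactor (c : ℂ) : Tendsto (shiftFactor c) atTop (𝓝 0) := by
  have h1 : Tendsto (fun t : ℝ ↦ t⁻¹) atTop (𝓝 0) := tendsto_inv_atTop_zero
  have h2 : Tendsto (fun t : ℝ ↦ log t / t) atTop (𝓝 0) :=
    isLittleO_log_id_atTop.tendsto_div_nhds_zero
  have := ((((h1.mul h1).const_mul (28 * ‖c‖)).add
    (((h1.const_mul (log 4)).add (h2.const_mul 4)).const_mul (96 * ‖c‖))).add
    (h1.const_mul 3)).add (((h1.mul h1).mul h1).const_mul 6)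
  simpa [shiftFactor] using! this

theorem proximity_shift_div_le_shiftFactor {f : ℂ → ℂ} (hf : Meromorphic f)
    (hf0 : ∀ z, meromorphicOrderAt f z ≠ ⊤) {c : ℂ} {t : ℝ} (ht : 1 ≤ t)
    (htc : 2 * ‖c‖ ≤ t ^ 3) :
    proximity (fun z ↦ f (z + c) / f z) ⊤ (t ^ 4)
      ≤ shiftFactor c t * ((2 + |log ‖meromorphicTrailingCoeffAt f 0‖|)
          * (characteristic f ⊤ (t ^ 4 + 2 * t ^ 3) + 1)) := by
  have ht0 : 0 < t := by linarith
  have ht3 : 1 ≤ t ^ 3 := one_le_pow₀ ht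
  have ht34 : t ^ 3 ≤ t ^ 4 := pow_le_pow_right₀ ht (by norm_num)
  -- The scales are `r = t⁴`, `R - r = R' - R = t³`, `η = t⁻²`, `h = 1 + 2‖c‖t`. The kernel factor
  -- is then `O(t⁻²)`, the number of zeros and poles `O(t X)`, and `η + 2h/r = O(t⁻²)`, so every
  -- term is `O(X log t / t)` or smaller.
  set r := t ^ 4 with hr
  set R := r + t ^ 3 with hR
  set R' := r + 2 * t ^ 3 with hR'
  set C₀ := |log ‖meromorphicTrailingCoeffAt f 0‖| with hC₀
  have hC₀0 : 0 ≤ C₀ := abs_nonneg _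
  set X := (2 + C₀) * (characteristic f ⊤ R' + 1) with hX
  have hr0 : 0 < r := by positivity
  have hR1 : 1 ≤ R := by linarith
  have hRR' : R < R' := by linarith
  have hcn := norm_nonneg c
  have hrR : r + ‖c‖ < R := by linarith
  have hη : 0 < (t ^ 2)⁻¹ := by positivity
  have hh1 : 1 ≤ 1 + 2 * ‖c‖ * t := by nlinarith
  have hh : (1 + ((t ^ 2)⁻¹)⁻¹) * ‖c‖ ^ 2 ≤ (1 + 2 * ‖c‖ * t) ^ 2 := by
    rw [inv_inv]
    have : ‖c‖ ^ 2 ≤ ‖c‖ ^ 2 * t ^ 2 := le_mul_of_one_le_right (by positivity) (one_le_pow₀ ht)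
    nlinarith [mul_nonneg hcn ht0.le, mul_nonneg (mul_nonneg hcn ht0.le) (mul_nonneg hcn ht0.le)]
  have key := proximity_shift_div_le hf hf0 hr0 hR1 hrR hη hh1 hh
  set n := zeroPoleCount f R with hn
  have hn0 : 0 ≤ n := zeroPoleCount_nonneg f R
  have hT'0 : 0 ≤ characteristic f ⊤ R' := characteristic_nonneg (by linarith)
  have hTinv := characteristic_inv_le hf (R := R') (by linarith)
  have hX0 : 0 ≤ X := by positivity
  have hXbound : characteristic f ⊤ R' + characteristic f⁻¹ ⊤ R' ≤ X := by
    rw [hX]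
    nlinarith
  have hm : proximity f ⊤ R + proximity f⁻¹ ⊤ R ≤ X := by
    have h1 := (proximity_le_characteristic f hR1).trans
      (characteristic_monotoneOn hf (show 0 < R by linarith) (show 0 < R' by linarith) hRR'.le)
    have h2 := (proximity_le_characteristic f⁻¹ hR1).trans
      (characteristic_monotoneOn hf.inv (show 0 < R by linarith) (show 0 < R' by linarith) hRR'.le)
    linarith
  have hnX : n ≤ 3 * t * X := by
    have h1 := zeroPoleCount_mul_log_le hf hR1 hRR'
    have h2 := logCounting_le_characteristic f R'
    have h3 := logCounting_le_characteristic f⁻¹ R'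
    have h4 : n * log (R' / R) ≤ X := by linarith
    -- `log (R'/R) ≥ 1 - R/R' = t³/R'`, and `R' ≤ 3t⁴`.
    have h5 : (3 * t)⁻¹ ≤ log (R' / R) := by
      have h6 := Real.one_sub_inv_le_log_of_pos (x := R' / R) (by apply div_pos <;> linarith)
      refine le_trans ?_ h6
      have e : 1 - (R' / R)⁻¹ = t ^ 3 / R' := by
        rw [inv_div, one_sub_div (by linarith)]
        congr 1
        rw [hR, hR']; ring
      rw [e, inv_eq_one_div, div_le_div_iff₀ (by positivity) (by linarith)]
      have : t ^ 3 * (3 * t) = 3 * r := by rw [hr]; ring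
      rw [this]
      linarith
    have h7 : n * (3 * t)⁻¹ ≤ X := (by gcongr : n * (3 * t)⁻¹ ≤ n * log (R' / R)).trans h4
    rw [← div_eq_mul_inv, div_le_iff₀ (by positivity)] at h7
    linarith
  have hlog : log (2 * R) ≤ log 4 + 4 * log t := by
    have : log (2 * R) ≤ log (4 * t ^ 4) := log_le_log (by linarith) (by linarith)
    rw [log_mul (x := 4) (by norm_num) (by positivity), log_pow] at this
    exact_mod_cast this
  have hlog0 : 0 ≤ log (2 * R) := log_nonneg (by linarith)
  have hK : 2 * ‖c‖ * R / (R - (r + ‖c‖)) ^ 2 ≤ 16 * ‖c‖ * (t⁻¹ * t⁻¹) := by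
    have h1 : t ^ 3 / 2 ≤ R - (r + ‖c‖) := by linarith
    calc 2 * ‖c‖ * R / (R - (r + ‖c‖)) ^ 2 ≤ 2 * ‖c‖ * (2 * t ^ 4) / (t ^ 3 / 2) ^ 2 := by
          gcongr
          linarith
      _ = 16 * ‖c‖ * (t⁻¹ * t⁻¹) := by
          field_simp
          ring
  have hB0 : 0 ≤ proximity f ⊤ R + proximity f⁻¹ ⊤ R + n * (2 * log (2 * R)) := by
    have h1 : 0 ≤ proximity f ⊤ R := proximity_nonneg R
    have h2 : 0 ≤ proximity f⁻¹ ⊤ R := proximity_nonneg R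
    positivity
  refine key.trans ?_
  have hlog4 : 0 ≤ log 4 + 4 * log t := hlog0.trans hlog
  calc 2 * ‖c‖ * R / (R - (r + ‖c‖)) ^ 2
          * (proximity f ⊤ R + proximity f⁻¹ ⊤ R + n * (2 * log (2 * R)))
        + n * ((t ^ 2)⁻¹ + 2 * ((1 + 2 * ‖c‖ * t) / r))
      ≤ 16 * ‖c‖ * (t⁻¹ * t⁻¹) * (X + 3 * t * X * (2 * (log 4 + 4 * log t)))
        + 3 * t * X * ((t ^ 2)⁻¹ + 2 * ((1 + 2 * ‖c‖ * t) / r)) := by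
        gcongr
    _ = shiftFactor c t * X := by
        rw [shiftFactor, hr]
        field_simp
        ring

theorem isLittleO_proximity_shift_div {f : ℂ → ℂ} (hf : Meromorphic f)
    (hf0 : ∀ z, meromorphicOrderAt f z ≠ ⊤) (c : ℂ) {A : ℝ} (hA : ∀ᶠ r in atTop, T r f ≤ r ^ A) :
    ∃ E, FiniteLogMeasure E ∧
      (fun r ↦ m r (fun z ↦ f (z + c) / f z)) =o[atTop ⊓ 𝓟 Eᶜ] (fun r ↦ T r f + 1) := by
  -- Adding 1 to `T` makes `τ ≥ 1`; raising the exponent by one absorbs it and makes the exponent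
  -- positive.
  obtain ⟨E, hE, hgrowth⟩ := exists_finiteLogMeasure_le_two_mul (τ := fun r ↦ T r f + 1)
    (A := max A 0 + 1) (fun x hx y hy hxy ↦ by
      simpa using characteristic_monotoneOn hf hx hy hxy)
    (fun r hr ↦ by simpa using characteristic_nonneg hr) (by positivity) (by
      filter_upwards [hA, eventually_ge_atTop 2] with r h1 h2
      have h3 : r ^ A ≤ r ^ max A 0 :=
        Real.rpow_le_rpow_of_exponent_le (by linarith) (le_max_left _ _)
      have h4 : 1 ≤ r ^ max A 0 := Real.one_le_rpow (by linarith) (le_max_right _ _)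
      rw [Real.rpow_add (by linarith), Real.rpow_one]
      nlinarith)
  refine ⟨E, hE, ?_⟩
  set C := 2 * (2 + |log ‖meromorphicTrailingCoeffAt f 0‖|) with hC
  have hC0 : 0 < C := by positivity
  have ht : Tendsto (fun r : ℝ ↦ r ^ (1 / 4 : ℝ)) atTop atTop :=
    tendsto_rpow_atTop (by norm_num)
  have hs : Tendsto (fun r : ℝ ↦ shiftFactor c (r ^ (1 / 4 : ℝ)) * C) atTop (𝓝 0) := by
    simpa using ((tendsto_shiftFactor c).comp ht).mul_const C
  have hlarge : ∀ᶠ r : ℝ in atTop, 2 * ‖c‖ ≤ (r ^ (1 / 4 : ℝ)) ^ 3 :=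
    ((tendsto_pow_atTop (by norm_num)).comp ht).eventually_ge_atTop _
  rw [isLittleO_iff]
  intro ε hε
  rw [eventually_inf_principal]
  filter_upwards [hgrowth, hlarge, eventually_ge_atTop 1,
    hs.eventually (gt_mem_nhds hε)] with r h1 h2 h3 h4 hrE
  have hT0 : 0 ≤ T r f := characteristic_nonneg h3
  rw [Real.norm_of_nonneg (proximity_nonneg r), Real.norm_of_nonneg (by positivity)]
  set t := r ^ (1 / 4 : ℝ) with htdef
  have ht1 : 1 ≤ t := Real.one_le_rpow h3 (by norm_num)
  have ht4 : t ^ 4 = r := by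
    rw [htdef, ← Real.rpow_natCast, ← Real.rpow_mul (by linarith)]; norm_num
  have ht3 : t ^ 3 = r ^ (3 / 4 : ℝ) := by
    rw [htdef, ← Real.rpow_natCast, ← Real.rpow_mul (by linarith)]; norm_num
  have key := proximity_shift_div_le_shiftFactor hf hf0 ht1 h2
  rw [ht4, ht3] at key
  have hg := h1 hrE
  have hsf : 0 ≤ shiftFactor c t := by
    have : 0 ≤ log t := log_nonneg ht1
    have : 0 ≤ log 4 := log_nonneg (by norm_num)
    have : 0 < t := by linarith
    rw [shiftFactor]
    positivity
  calc m r (fun z ↦ f (z + c) / f z)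
      ≤ shiftFactor c t * ((2 + |log ‖meromorphicTrailingCoeffAt f 0‖|) * (2 * (T r f + 1))) := by
        refine key.trans ?_
        gcongr
    _ = shiftFactor c t * C * (T r f + 1) := by rw [hC]; ring
    _ ≤ ε * (T r f + 1) := by gcongr

/-! ### Identity of meromorphic functions -/

lemma eventually_codiscrete_iff {P : ℂ → Prop} :
    (∀ᶠ z in codiscrete ℂ, P z) ↔ ∀ x, ∀ᶠ z in 𝓝[≠] x, P z := by
  change {z | P z} ∈ codiscreteWithin Set.univ ↔ _
  rw [mem_codiscreteWithin_iff_forall_mem_nhdsNE]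
  simp [Filter.Eventually]

lemma meromorphicOrderAt_ne_top {f : ℂ → ℂ} (hf : Meromorphic f) (h : ¬ MerEq f 0) (z : ℂ) :
    meromorphicOrderAt f z ≠ ⊤ := by
  intro hz
  apply h
  have hall : ∀ u : ℂ, meromorphicOrderAt f u = ⊤ := by
    by_contra hcon
    push Not at hcon
    obtain ⟨u, hu⟩ := hcon
    have := (hf.meromorphicOn (s := Set.univ)).exists_meromorphicOrderAt_ne_top_iff_forall
      isConnected_univ |>.1 ⟨⟨u, trivial⟩, hu⟩ ⟨z, trivial⟩
    exact this hz
  exact eventually_codiscrete_iff.2 fun x ↦ meromorphicOrderAt_eq_top_iff.1 (hall x)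

lemma eventually_codiscrete_ne_zero {f : ℂ → ℂ} (hf : Meromorphic f) (h : ¬ MerEq f 0) :
    ∀ᶠ z in codiscrete ℂ, f z ≠ 0 :=
  eventually_codiscrete_iff.2 fun x ↦
    (meromorphicOrderAt_ne_top_iff_eventually_ne_zero (hf x)).1 (meromorphicOrderAt_ne_top hf h x)

lemma eventually_codiscrete_add_const {P : ℂ → Prop} (hP : ∀ᶠ z in codiscrete ℂ, P z) (c : ℂ) :
    ∀ᶠ z in codiscrete ℂ, P (z + c) :=
  codiscreteWithin_add_const hP fun _ _ ↦ trivial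

lemma meromorphic_comp_add_const {f : ℂ → ℂ} (hf : Meromorphic f) (c : ℂ) :
    Meromorphic fun z ↦ f (z + c) := fun z ↦
  (hf (z + c)).comp_analyticAt (g := fun z ↦ z + c) (by fun_prop)

lemma meromorphic_diff {f : ℂ → ℂ} (hf : Meromorphic f) (c : ℂ) : Meromorphic (diff c f) :=
  (meromorphic_comp_add_const hf c).sub hf

/-- Besides the `a_k`, this is applied to constants: `f` is nonconstant, so its characteristic tends
to infinity. -/
lemma not_merEq_sub_zero {c : ℂ} {f a : ℂ → ℂ} (hΔ : ¬ MerEq (diff c f) 0)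
    (ha : PeriodicMer c a) : ¬ MerEq (fun z ↦ f z - a z) 0 := by
  intro h
  apply hΔ
  filter_upwards [h, eventually_codiscrete_add_const h c, ha] with z h1 h2 h3
  simp only [Pi.zero_apply, sub_eq_zero] at h1 h2
  simp [diff, h1, h2, h3]

/-! ### Growth of the characteristic function -/

lemma FiniteOrder.exists_eventually_le_rpow {f : ℂ → ℂ} (h : FiniteOrder f) :
    ∃ A : ℝ, 0 ≤ A ∧ ∀ᶠ r in atTop, T r f ≤ r ^ A := by
  obtain ⟨B, hB, -⟩ := EReal.lt_iff_exists_real_btwn.1 h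
  refine ⟨max B 0, le_max_right _ _, ?_⟩
  filter_upwards [eventually_lt_of_limsup_lt hB, eventually_gt_atTop 1] with r h1 h2
  have h3 : log⁺ (T r f) / log r < B := by exact_mod_cast h1
  have hlr : 0 < log r := log_pos h2
  rw [div_lt_iff₀ hlr] at h3
  have hT0 : 0 ≤ T r f := characteristic_nonneg h2.le
  rcases hT0.eq_or_lt with h0 | h0
  · rw [← h0]; positivity
  · have h4 : log (T r f) ≤ log (r ^ max B 0) := by
      rw [Real.log_rpow (by linarith)]
      calc log (T r f) ≤ log⁺ (T r f) := le_max_right _ _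
        _ ≤ B * log r := h3.le
        _ ≤ max B 0 * log r := by gcongr; exact le_max_left _ _
    exact (log_le_log_iff h0 (by positivity)).1 h4

/-- The characteristic function of a nonconstant meromorphic function is unbounded. -/
lemma tendsto_characteristic_atTop {f : ℂ → ℂ} (hf : Meromorphic f)
    (hconst : ∀ a : ℂ, ¬ MerEq (fun z ↦ f z - a) 0) :
    Tendsto (fun r ↦ T r f) atTop atTop := by
  -- Subtracting the value at a point of analyticity creates a zero, which alone makes `N(r, 1/g)`
  -- grow at least like `log r`.
  obtain ⟨z₀, hz₀⟩ := (hf 0).eventually_analyticAt.exists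
  set g : ℂ → ℂ := fun z ↦ f z - f z₀ with hg
  have hgm : Meromorphic g := hf.sub (Meromorphic.const _)
  have hga : AnalyticAt ℂ g z₀ := hz₀.sub analyticAt_const
  have htop := meromorphicOrderAt_ne_top hgm (hconst (f z₀)) z₀
  have hpos : 1 ≤ divisor g Set.univ z₀ := by
    rw [divisor_apply hgm.meromorphicOn (Set.mem_univ _)]
    have h1 : meromorphicOrderAt g z₀ ≠ 0 := by
      rw [Ne, hga.meromorphicNFAt.meromorphicOrderAt_eq_zero_iff]
      simp [hg]
    have h2 : 0 ≤ meromorphicOrderAt g z₀ := hga.meromorphicOrderAt_nonneg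
    lift meromorphicOrderAt g z₀ to ℤ using htop with n
    have h3 : n ≠ 0 := by exact_mod_cast h1
    have h4 : 0 ≤ n := by exact_mod_cast h2
    simp only [WithTop.untop₀_coe]
    omega
  have hsingle : Function.locallyFinsuppWithin.single z₀ (1 : ℤ) ≤ (divisor g Set.univ)⁺ := by
    intro u
    rw [Function.locallyFinsuppWithin.single_apply]
    split_ifs with h
    · subst h
      exact hpos.trans (le_posPart _)
    · exact posPart_nonneg _
  set C₁ := |log ‖meromorphicTrailingCoeffAt g 0‖|
  set C₂ := log⁺ ‖f z₀‖ + log 2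
  have hlow : ∀ᶠ r in atTop, log r + (- log ‖z₀‖ - C₁ - C₂) ≤ T r f := by
    filter_upwards [eventually_ge_atTop ‖z₀‖, eventually_ge_atTop 1] with r h1 h2
    have e1 := Function.locallyFinsuppWithin.logCounting_le hsingle h2
    rw [Function.locallyFinsuppWithin.logCounting_single_eq_log_sub_const h1, ← logCounting_zero,
      ← logCounting_inv] at e1
    have e2 := logCounting_le_characteristic g⁻¹ r
    have e3 := characteristic_inv_le hgm (R := r) (by linarith)
    have e4 := abs_le.1 (abs_characteristic_sub_characteristic_shift_le (a₀ := f z₀) (r := r) hf)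
    have e5 := e4.1
    push_cast at e1
    change characteristic g⁻¹ ⊤ r ≤ characteristic g ⊤ r + C₁ at e3
    change -C₂ ≤ T r f - characteristic g ⊤ r at e5
    linarith
  exact tendsto_atTop_mono' _ hlow (tendsto_atTop_add_const_right _ _ tendsto_log_atTop)

lemma lintegral_inv_Icc_mul {r K : ℝ} (hr : 0 < r) (hK : 1 ≤ K) :
    ∫⁻ x in Set.Icc r (K * r), ENNReal.ofReal x⁻¹ = ENNReal.ofReal (log K) := by
  have hle : r ≤ K * r := le_mul_of_one_le_left hr.le hK
  have hci : IntegrableOn (fun x : ℝ ↦ x⁻¹) (Set.Icc r (K * r)) :=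
    (continuousOn_inv₀.mono fun x hx ↦ (hr.trans_le hx.1).ne').integrableOn_Icc
  rw [← ofReal_integral_eq_lintegral_ofReal hci, integral_Icc_eq_integral_Ioc,
    ← intervalIntegral.integral_of_le hle, integral_inv_of_pos hr (by positivity),
    mul_div_cancel_right₀ _ hr.ne']
  filter_upwards [ae_restrict_mem measurableSet_Icc] with x hx
  exact inv_nonneg.2 (hr.trans_le hx.1).le

/-- A small function is dominated by `f` on a larger disk, without an exceptional set. -/
lemma exists_characteristic_le_mul {f a : ℂ → ℂ} (hf : Meromorphic f) (ha : a ∈ smallFunctions f) :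
    ∃ K : ℝ, 1 ≤ K ∧ ∀ᶠ r in atTop, T r a ≤ T (K * r) f := by
  obtain ⟨ham, E, hE, hlo⟩ := ha
  set M := (∫⁻ r in E, ENNReal.ofReal r⁻¹).toReal with hM
  have hM0 : 0 ≤ M := ENNReal.toReal_nonneg
  have hMe : ∫⁻ r in E, ENNReal.ofReal r⁻¹ = ENNReal.ofReal M :=
    (ENNReal.ofReal_toReal hE.2.2.ne).symm
  -- `[r, e^(M+1) r]` has logarithmic measure `M + 1`, more than that of `E`, so it contains a
  -- radius outside `E`. Monotonicity of both characteristics does the rest. The resulting bound at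
  -- every large radius is what the growth lemma for `f - a` needs.
  refine ⟨exp (M + 1), one_le_exp (by linarith), ?_⟩
  have hlo1 := isLittleO_iff.1 hlo one_pos
  rw [eventually_inf_principal] at hlo1
  obtain ⟨r₀, hr₀⟩ := eventually_atTop.1 hlo1
  filter_upwards [eventually_ge_atTop r₀, eventually_ge_atTop 1] with r h1 h2
  have hr : 0 < r := by linarith
  have hex : ∃ s ∈ Set.Icc r (exp (M + 1) * r), s ∉ E := by
    by_contra hcon
    push Not at hcon
    have hle := lintegral_mono_set (μ := volume) (f := fun x : ℝ ↦ ENNReal.ofReal x⁻¹) hcon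
    rw [lintegral_inv_Icc_mul hr (one_le_exp (by linarith)), hMe, log_exp,
      ENNReal.ofReal_le_ofReal_iff hM0] at hle
    linarith
  obtain ⟨s, hs, hsE⟩ := hex
  have hs0 : 0 < s := hr.trans_le hs.1
  have h3 := hr₀ s (h1.trans hs.1) hsE
  rw [Real.norm_of_nonneg (characteristic_nonneg (h2.trans hs.1)),
    Real.norm_of_nonneg (characteristic_nonneg (h2.trans hs.1)), one_mul] at h3
  exact (characteristic_monotoneOn ham hr hs0 hs.1).trans
    (h3.trans (characteristic_monotoneOn hf hs0 (hs0.trans_le hs.2) hs.2))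

lemma characteristic_sub_le {f a : ℂ → ℂ} (hf : Meromorphic f) (ha : Meromorphic a) {r : ℝ}
    (hr : 1 ≤ r) : T r (fun z ↦ f z - a z) ≤ T r f + T r a + log 2 := by
  have h1 := characteristic_add_top_le hf ha.neg hr
  have h2 : T r (-a) = T r a := by
    have hdiv : divisor (-a) Set.univ = divisor a Set.univ := by
      ext z
      rw [divisor_apply ha.neg.meromorphicOn (Set.mem_univ z),
        divisor_apply ha.meromorphicOn (Set.mem_univ z), meromorphicOrderAt_neg (f := a)]
    simp only [T, characteristic, Pi.add_apply, proximity_top, logCounting_top, Pi.neg_apply,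
      norm_neg, hdiv]
  have e : (fun z ↦ f z - a z) = f + -a := by ext z; simp [sub_eq_add_neg]
  rw [e]
  change T r (f + -a) ≤ T r f + T r (-a) + log 2 at h1
  rwa [h2] at h1

lemma exists_eventually_characteristic_sub_le_rpow {f a : ℂ → ℂ} (hf : Meromorphic f)
    (hord : FiniteOrder f) (ha : a ∈ smallFunctions f) :
    ∃ A : ℝ, ∀ᶠ r in atTop, T r (fun z ↦ f z - a z) ≤ r ^ A := by
  obtain ⟨A, hA0, hA⟩ := hord.exists_eventually_le_rpow
  obtain ⟨K, hK1, hK⟩ := exists_characteristic_le_mul hf ha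
  refine ⟨A + 1, ?_⟩
  have hK0 : 0 < K := by linarith
  filter_upwards [hA, hK, (tendsto_id.const_mul_atTop hK0).eventually hA,
    eventually_ge_atTop (2 + K ^ A), eventually_ge_atTop 1] with r h1 h2 h3 h4 h5
  have hr0 : 0 < r := by linarith
  change T (K * r) f ≤ (K * r) ^ A at h3
  rw [Real.mul_rpow hK0.le hr0.le] at h3
  have h6 := characteristic_sub_le hf ha.1 h5
  have h7 : 1 ≤ r ^ A := Real.one_le_rpow h5 hA0
  have h8 : log 2 ≤ 1 := by
    have := log_le_sub_one_of_pos (x := 2) (by norm_num)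
    linarith
  rw [Real.rpow_add hr0, Real.rpow_one]
  nlinarith

/-! ### Small error terms -/

lemma IsSmallError.add {f : ℂ → ℂ} {φ ψ : ℝ → ℝ} (hφ : IsSmallError f φ) (hψ : IsSmallError f ψ) :
    IsSmallError f fun r ↦ φ r + ψ r := by
  obtain ⟨E, hE, h1⟩ := hφ
  obtain ⟨F, hF, h2⟩ := hψ
  refine ⟨E ∪ F, hE.union hF, (h1.mono ?_).add (h2.mono ?_)⟩
  · exact inf_le_inf_left _ (Filter.principal_mono.2 (Set.compl_subset_compl.2 Set.subset_union_left))
  · exact inf_le_inf_left _ (Filter.principal_mono.2 (Set.compl_subset_compl.2 Set.subset_union_right))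

lemma IsSmallError.zero (f : ℂ → ℂ) : IsSmallError f fun _ ↦ 0 :=
  ⟨∅, finiteLogMeasure_empty, isLittleO_zero _ _⟩

lemma IsSmallError.sum {ι : Type*} {f : ℂ → ℂ} {φ : ι → ℝ → ℝ} (s : Finset ι)
    (h : ∀ i ∈ s, IsSmallError f (φ i)) : IsSmallError f fun r ↦ ∑ i ∈ s, φ i r := by
  classical
  induction s using Finset.induction_on with
  | empty => simpa using IsSmallError.zero f
  | insert i s hi ih =>
    simp_rw [Finset.sum_insert hi]
    exact (h i (Finset.mem_insert_self i s)).add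
      (ih fun j hj ↦ h j (Finset.mem_insert_of_mem hj))

lemma IsSmallError.const_mul {f : ℂ → ℂ} {φ : ℝ → ℝ} (h : IsSmallError f φ) (C : ℝ) :
    IsSmallError f fun r ↦ C * φ r := by
  obtain ⟨E, hE, h1⟩ := h
  exact ⟨E, hE, h1.const_mul_left C⟩

lemma IsSmallError.of_abs_le {f : ℂ → ℂ} {φ ψ : ℝ → ℝ} (h : IsSmallError f ψ)
    (hle : ∀ᶠ r in atTop, |φ r| ≤ |ψ r|) : IsSmallError f φ := by
  obtain ⟨E, hE, h1⟩ := h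
  exact ⟨E, hE, (IsBigO.of_bound' (hle.filter_mono inf_le_left)).trans_isLittleO h1⟩

lemma IsSmallError.const {f : ℂ → ℂ} (h : Tendsto (fun r ↦ T r f) atTop atTop) (C : ℝ) :
    IsSmallError f fun _ ↦ C :=
  ⟨∅, finiteLogMeasure_empty,
    (isLittleO_const_left.2 (Or.inr (tendsto_norm_atTop_atTop.comp h))).mono inf_le_left⟩

/-- The proximity function of the shift quotient of `f - a`, for small `a`, is a small error. -/
theorem isSmallError_proximity_shift_div {c : ℂ} {f a : ℂ → ℂ} (hf : Meromorphic f)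
    (hord : FiniteOrder f) (hT : Tendsto (fun r ↦ T r f) atTop atTop) (ha : a ∈ smallFunctions f)
    (h0 : ¬ MerEq (fun z ↦ f z - a z) 0) :
    IsSmallError f fun r ↦ m r (fun z ↦ (f (z + c) - a (z + c)) / (f z - a z)) := by
  have hg : Meromorphic fun z ↦ f z - a z := hf.sub ha.1
  obtain ⟨A, hA⟩ := exists_eventually_characteristic_sub_le_rpow hf hord ha
  obtain ⟨E, hE, h1⟩ := isLittleO_proximity_shift_div hg (meromorphicOrderAt_ne_top hg h0) c hA
  obtain ⟨F, hF, h2⟩ := ha.2.add (IsSmallError.const hT (log 2 + 1))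
  refine ⟨E ∪ F, hE.union hF, ?_⟩
  have hEle : atTop ⊓ 𝓟 (E ∪ F)ᶜ ≤ atTop ⊓ 𝓟 Eᶜ :=
    inf_le_inf_left _ (Filter.principal_mono.2 (Set.compl_subset_compl.2 Set.subset_union_left))
  have hFle : atTop ⊓ 𝓟 (E ∪ F)ᶜ ≤ atTop ⊓ 𝓟 Fᶜ :=
    inf_le_inf_left _ (Filter.principal_mono.2 (Set.compl_subset_compl.2 Set.subset_union_right))
  -- The error is small relative to `T(r, f - a) + 1`, which is `O(T(r, f))` because `a` is small
  -- and `T(r, f) → ∞`.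
  refine (h1.mono hEle).trans_isBigO ?_
  have h3 : (fun r ↦ T r f + (T r a + (log 2 + 1))) =O[atTop ⊓ 𝓟 (E ∪ F)ᶜ] fun r ↦ T r f :=
    (isBigO_refl _ _).add (h2.mono hFle).isBigO
  refine IsBigO.trans (IsBigO.of_bound' ?_) h3
  refine Eventually.filter_mono inf_le_left ?_
  filter_upwards [eventually_ge_atTop 1] with r hr
  have e1 : 0 ≤ T r (fun z ↦ f z - a z) := characteristic_nonneg hr
  have e2 := characteristic_sub_le hf ha.1 hr
  rw [Real.norm_of_nonneg (by linarith)]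
  exact le_trans (by linarith) (le_abs_self _)

/-! ### Combination -/

/-- Let `a l` be nearest to `w`. For `k ≠ l`, `‖a k - a l‖ ≤ 2‖w - a k‖`, so that term is bounded by
the separation sum. Only the term of `l` uses `1/d`, through `1/(w - a l) = (1/d)(d/(w - a l))`.
Diagonal terms vanish since `2/0 = 0`. -/
lemma sum_posLog_inv_sub_le {ι : Type*} [Fintype ι] [Nonempty ι] {w d : ℂ} {a : ι → ℂ}
    (hd : d ≠ 0) (hw : ∀ k, w - a k ≠ 0) (ha : ∀ i j, i ≠ j → a i - a j ≠ 0) :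
    ∑ k, log⁺ ‖1 / (w - a k)‖ ≤ log⁺ ‖1 / d‖ + ∑ k, log⁺ ‖d / (w - a k)‖
      + Fintype.card ι * ∑ i, ∑ j, log⁺ ‖2 / (a i - a j)‖ := by
  classical
  obtain ⟨l, hl⟩ := Finite.exists_min fun k ↦ ‖w - a k‖
  set P := ∑ i, ∑ j, log⁺ ‖2 / (a i - a j)‖ with hP
  have hterm : ∀ i j, log⁺ ‖2 / (a i - a j)‖ ≤ P := fun i j ↦
    (Finset.single_le_sum (f := fun j ↦ log⁺ ‖2 / (a i - a j)‖) (fun _ _ ↦ posLog_nonneg)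
      (Finset.mem_univ j)).trans
    (Finset.single_le_sum (f := fun i ↦ ∑ j, log⁺ ‖2 / (a i - a j)‖)
      (fun _ _ ↦ Finset.sum_nonneg fun _ _ ↦ posLog_nonneg) (Finset.mem_univ i))
  have hP0 : 0 ≤ P := posLog_nonneg.trans (hterm l l)
  have hother : ∀ k ∈ Finset.univ.erase l, log⁺ ‖1 / (w - a k)‖ ≤ P := by
    intro k hk
    have hkl : k ≠ l := Finset.ne_of_mem_erase hk
    refine le_trans (posLog_le_posLog (norm_nonneg _) ?_) (hterm k l)
    rw [norm_div, norm_div, norm_one, Complex.norm_two,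
      div_le_div_iff₀ (norm_pos_iff.2 (hw k)) (norm_pos_iff.2 (ha k l hkl))]
    have h1 : ‖a k - a l‖ ≤ ‖w - a l‖ + ‖w - a k‖ := by
      rw [show a k - a l = (w - a l) - (w - a k) by ring]
      exact norm_sub_le _ _
    linarith [hl k]
  have hl1 : log⁺ ‖1 / (w - a l)‖ ≤ log⁺ ‖1 / d‖ + ∑ k, log⁺ ‖d / (w - a k)‖ := by
    have e : 1 / (w - a l) = 1 / d * (d / (w - a l)) := by
      have := hw l
      field_simp
    rw [e, norm_mul]
    refine posLog_mul.trans ?_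
    gcongr
    exact Finset.single_le_sum (f := fun k ↦ log⁺ ‖d / (w - a k)‖) (fun _ _ ↦ posLog_nonneg)
      (Finset.mem_univ l)
  rw [← Finset.add_sum_erase _ _ (Finset.mem_univ l)]
  have h2 := Finset.sum_le_card_nsmul _ _ _ hother
  have h3 : ((Finset.univ.erase l).card : ℝ) ≤ Fintype.card ι := by
    exact_mod_cast Finset.card_le_univ _
  rw [nsmul_eq_mul] at h2
  have h4 : ((Finset.univ.erase l).card : ℝ) * P ≤ Fintype.card ι * P := by gcongr
  linarith

theorem sum_proximity_inv_sub_le {ι : Type*} [Fintype ι] [Nonempty ι] {f d : ℂ → ℂ}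
    {a : ι → ℂ → ℂ} (hf : Meromorphic f) (hdm : Meromorphic d) (ham : ∀ k, Meromorphic (a k))
    (hd : ¬ MerEq d 0) (hw : ∀ k, ¬ MerEq (fun z ↦ f z - a k z) 0)
    (ha : ∀ i j, i ≠ j → ¬ MerEq (fun z ↦ a i z - a j z) 0) {r : ℝ} (hr : r ≠ 0) :
    ∑ k, m r (fun z ↦ 1 / (f z - a k z)) ≤ m r (fun z ↦ 1 / d z)
      + ∑ k, m r (fun z ↦ d z / (f z - a k z))
      + Fintype.card ι * ∑ i, ∑ j, m r (fun z ↦ 2 / (a i z - a j z)) := by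
  have hint : ∀ {g : ℂ → ℂ}, Meromorphic g → CircleIntegrable (fun z ↦ log⁺ ‖g z‖) 0 r :=
    fun hg ↦ hg.meromorphicOn.circleIntegrable_posLog_norm
  have i1 : ∀ k ∈ Finset.univ, CircleIntegrable (fun z ↦ log⁺ ‖1 / (f z - a k z)‖) 0 r := fun k _ ↦
    hint ((Meromorphic.const 1).div (hf.sub (ham k)))
  have i2 : CircleIntegrable (fun z ↦ log⁺ ‖1 / d z‖) 0 r := hint ((Meromorphic.const 1).div hdm)
  have i3 : ∀ k ∈ Finset.univ, CircleIntegrable (fun z ↦ log⁺ ‖d z / (f z - a k z)‖) 0 r :=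
    fun k _ ↦ hint (hdm.div (hf.sub (ham k)))
  have i4 : ∀ i, ∀ j ∈ Finset.univ, CircleIntegrable (fun z ↦ log⁺ ‖2 / (a i z - a j z)‖) 0 r :=
    fun i j _ ↦ hint ((Meromorphic.const 2).div ((ham i).sub (ham j)))
  have i5 : ∀ i ∈ Finset.univ,
      CircleIntegrable (fun z ↦ ∑ j, log⁺ ‖2 / (a i z - a j z)‖) 0 r := fun i _ ↦
    CircleIntegrable.fun_sum _ (i4 i)
  have i6 : CircleIntegrable (fun z ↦ ∑ i, ∑ j, log⁺ ‖2 / (a i z - a j z)‖) 0 r :=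
    CircleIntegrable.fun_sum _ i5
  have i7 : CircleIntegrable
      (fun z ↦ (Fintype.card ι : ℝ) * ∑ i, ∑ j, log⁺ ‖2 / (a i z - a j z)‖) 0 r :=
    i6.const_smul (a := (Fintype.card ι : ℝ))
  have i8 : CircleIntegrable (fun z ↦ ∑ k, log⁺ ‖d z / (f z - a k z)‖) 0 r :=
    CircleIntegrable.fun_sum _ i3
  have i9 : CircleIntegrable (fun z ↦ log⁺ ‖1 / d z‖ + ∑ k, log⁺ ‖d z / (f z - a k z)‖) 0 r :=
    i2.add i8
  have h1 : ∀ᶠ z in codiscrete ℂ, ∀ k, f z - a k z ≠ 0 :=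
    eventually_all.2 fun k ↦ eventually_codiscrete_ne_zero (hf.sub (ham k)) (hw k)
  have h2 : ∀ᶠ z in codiscrete ℂ, ∀ i j, i ≠ j → a i z - a j z ≠ 0 :=
    eventually_all.2 fun i ↦ eventually_all.2 fun j ↦ eventually_imp_distrib_left.2 fun hij ↦
      eventually_codiscrete_ne_zero ((ham i).sub (ham j)) (ha i j hij)
  have hpt : ∀ᶠ z in codiscrete ℂ, ∑ k, log⁺ ‖1 / (f z - a k z)‖ ≤ log⁺ ‖1 / d z‖
      + ∑ k, log⁺ ‖d z / (f z - a k z)‖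
      + Fintype.card ι * ∑ i, ∑ j, log⁺ ‖2 / (a i z - a j z)‖ := by
    filter_upwards [h1, h2, eventually_codiscrete_ne_zero hdm hd] with z e1 e2 e3
    exact sum_posLog_inv_sub_le e3 e1 e2
  have key := circleAverage_mono_codiscreteWithin hr (CircleIntegrable.fun_sum _ i1) (i9.add i7)
    (hpt.filter_mono (codiscreteWithin_mono (Set.subset_univ _)))
  rw [circleAverage_add i9 i7, circleAverage_fun_add i2 i8, circleAverage_fun_sum i1,
    circleAverage_fun_sum i3] at key
  have := circleAverage_fun_smul (a := (Fintype.card ι : ℝ))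
    (f := fun z : ℂ ↦ ∑ i, ∑ j, log⁺ ‖2 / (a i z - a j z)‖) (c := 0) (R := r)
  simp only [smul_eq_mul] at this
  rw [this, circleAverage_fun_sum i5, Finset.sum_congr rfl fun i _ ↦ circleAverage_fun_sum (i4 i)]
    at key
  simpa only [m, proximity_top] using key

/-- `m (r, Δ_c f / (f - a))` in terms of the shift quotient of `f - a`, for periodic `a`. -/
lemma proximity_diff_div_le {c : ℂ} {f a : ℂ → ℂ} (hf : Meromorphic f) (ha : Meromorphic a)
    (hper : PeriodicMer c a) (h0 : ¬ MerEq (fun z ↦ f z - a z) 0) {r : ℝ} (hr : r ≠ 0) :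
    m r (fun z ↦ diff c f z / (f z - a z))
      ≤ m r (fun z ↦ (f (z + c) - a (z + c)) / (f z - a z)) + log 2 := by
  have hg : Meromorphic fun z ↦ f z - a z := hf.sub ha
  have hgc := meromorphic_comp_add_const hg c
  have e : (fun z ↦ diff c f z / (f z - a z)) =ᶠ[codiscrete ℂ]
      (fun z ↦ (f (z + c) - a (z + c)) / (f z - a z)) + fun _ ↦ (-1 : ℂ) := by
    filter_upwards [hper, eventually_codiscrete_ne_zero hg h0] with z h1 h2
    simp only [Pi.add_apply, diff, h1]
    field_simp
    ring
  have h1 := proximity_add_top_le (hgc.div hg) (Meromorphic.const (-1 : ℂ)) r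
  rw [m, proximity_congr_codiscrete e hr]
  refine h1.trans ?_
  simp [Pi.add_apply, Pi.div_def]

lemma isSmallError_proximity_two_div_sub {f a b : ℂ → ℂ}
    (hT : Tendsto (fun r ↦ T r f) atTop atTop) (ha : a ∈ smallFunctions f)
    (hb : b ∈ smallFunctions f) :
    IsSmallError f fun r ↦ m r (fun z ↦ 2 / (a z - b z)) := by
  have hab : Meromorphic fun z ↦ a z - b z := ha.1.sub hb.1
  set C := log⁺ ‖(2 : ℂ)‖ + (log 2 + |log ‖meromorphicTrailingCoeffAt (fun z ↦ a z - b z) 0‖|)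
  refine ((ha.2.add hb.2).add (IsSmallError.const hT C)).of_abs_le ?_
  filter_upwards [eventually_ge_atTop 1] with r hr
  have h0 : 0 ≤ m r (fun z ↦ 2 / (a z - b z)) := proximity_nonneg r
  rw [abs_of_nonneg h0]
  refine le_trans ?_ (le_abs_self _)
  have h1 := proximity_mul_top_le (Meromorphic.const (2 : ℂ)) hab.inv r
  have h2 := proximity_le_characteristic (fun z ↦ a z - b z)⁻¹ hr
  have h3 := characteristic_inv_le hab (R := r) (by linarith)
  have h4 := characteristic_sub_le ha.1 hb.1 hr
  rw [Pi.add_apply, proximity_const] at h1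
  have e : (fun z ↦ 2 / (a z - b z)) = (fun _ ↦ (2 : ℂ)) * (fun z ↦ a z - b z)⁻¹ := by
    ext z; simp [div_eq_mul_inv]
  rw [e]
  simp only [C]
  linarith

end DifferenceNevanlinna

/-! ### The second main theorem for differences -/

theorem mainTheorem2 (c : ℂ) (f : ℂ → ℂ) (hf : Meromorphic f)
    (hord : DifferenceNevanlinna.FiniteOrder f)
    (hΔ : ¬ DifferenceNevanlinna.MerEq (DifferenceNevanlinna.diff c f) 0)
    (q : ℕ) (hq : 2 ≤ q) (a : Fin q → ℂ → ℂ)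
    (hdist : ∀ i j, i ≠ j → ¬ DifferenceNevanlinna.MerEq (a i) (a j))
    (hper : ∀ k, DifferenceNevanlinna.PeriodicMer c (a k))
    (hsmall : ∀ k, a k ∈ DifferenceNevanlinna.smallFunctions f) :
    ∃ S : ℝ → ℝ, DifferenceNevanlinna.IsSmallError f S ∧
      ∀ r : ℝ, 0 < r →
        DifferenceNevanlinna.m r f
            + ∑ k, DifferenceNevanlinna.m r (fun z ↦ 1 / (f z - a k z))
          ≤ 2 * DifferenceNevanlinna.T r f - DifferenceNevanlinna.Npair c r f + S r := by
  open DifferenceNevanlinna ValueDistribution in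
  have hconst : ∀ b : ℂ, PeriodicMer c fun _ ↦ b := fun b ↦ Eventually.of_forall fun _ ↦ rfl
  have hT : Tendsto (fun r ↦ T r f) atTop atTop :=
    tendsto_characteristic_atTop hf fun b ↦ not_merEq_sub_zero hΔ (hconst b)
  have hzero : (fun _ ↦ 0 : ℂ → ℂ) ∈ smallFunctions f := by
    refine ⟨Meromorphic.const 0, ?_⟩
    have : (fun r ↦ T r (fun _ ↦ 0)) = fun _ ↦ 0 := by
      ext r; simp [T, characteristic]
    rw [this]
    exact IsSmallError.zero f
  have hΔm := meromorphic_diff hf c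
  have hfk : ∀ k, ¬ MerEq (fun z ↦ f z - a k z) 0 := fun k ↦ not_merEq_sub_zero hΔ (hper k)
  have hf0 : ¬ MerEq (fun z ↦ f z - 0) 0 := not_merEq_sub_zero hΔ (hconst 0)
  have : Nonempty (Fin q) := ⟨⟨0, by omega⟩⟩
  set C := |Real.log ‖meromorphicTrailingCoeffAt (diff c f) 0‖|
  set err : ℝ → ℝ := fun r ↦ (m r (fun z ↦ (f (z + c) - 0) / (f z - 0))
    + ∑ k, (m r (fun z ↦ (f (z + c) - a k (z + c)) / (f z - a k z)) + Real.log 2))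
    + (Fintype.card (Fin q) * ∑ i, ∑ j, m r (fun z ↦ 2 / (a i z - a j z)))
    + (Real.log 2 + C)
  have herr : IsSmallError f err := by
    refine (((isSmallError_proximity_shift_div hf hord hT hzero hf0).add
      (IsSmallError.sum _ fun k _ ↦ (isSmallError_proximity_shift_div hf hord hT (hsmall k)
        (hfk k)).add (IsSmallError.const hT _))).add
      ((IsSmallError.sum _ fun i _ ↦ IsSmallError.sum _ fun j _ ↦
        isSmallError_proximity_two_div_sub hT (hsmall i) (hsmall j)).const_mul _)).add
      (IsSmallError.const hT _)
  set gap : ℝ → ℝ := fun r ↦ m r f + ∑ k, m r (fun z ↦ 1 / (f z - a k z))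
    - (2 * T r f - Npair c r f)
  -- Taking the positive part of the defect as `S` makes the inequality hold for every `r > 0`; only
  -- `S ≤ |err|` for `r ≥ 1` has to be proved.
  refine ⟨fun r ↦ max 0 (gap r), herr.of_abs_le ?_, fun r _ ↦ ?_⟩
  · filter_upwards [eventually_ge_atTop 1] with r hr
    rw [abs_of_nonneg (le_max_left _ _)]
    refine max_le (abs_nonneg _) (le_trans ?_ (le_abs_self _))
    have hr0 : r ≠ 0 := by linarith
    have h1 := sum_proximity_inv_sub_le hf hΔm (fun k ↦ (hsmall k).1) hΔ hfk
      (fun i j hij h ↦ hdist i j hij (by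
        filter_upwards [h] with z hz using sub_eq_zero.1 hz)) hr0
    have h2 := Finset.sum_le_sum fun k (_ : k ∈ Finset.univ) ↦
      proximity_diff_div_le hf (hsmall k).1 (hper k) (hfk k) hr0
    have h3 : m r (diff c f)
        ≤ m r f + (m r (fun z ↦ (f (z + c) - 0) / (f z - 0)) + Real.log 2) := by
      have e : diff c f =ᶠ[codiscrete ℂ] f * fun z ↦ diff c f z / (f z - 0) := by
        filter_upwards [eventually_codiscrete_ne_zero (hf.sub (Meromorphic.const 0)) hf0]
          with z hz
        have hz' : f z ≠ 0 := by simpa using hz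
        simp only [Pi.mul_apply, sub_zero]
        field_simp
      have e1 := proximity_mul_top_le hf (hΔm.div (hf.sub (Meromorphic.const 0))) r
      have e2 := proximity_diff_div_le hf (Meromorphic.const 0) (hconst 0) hf0 hr0
      rw [m, proximity_congr_codiscrete e hr0]
      refine le_trans e1 ?_
      exact add_le_add le_rfl e2
    -- Jensen's formula trades `m(r, 1/Δ_c f)` for `T(r, Δ_c f) - N(r, 1/Δ_c f)` up to the constant
    -- `C`.
    have h4 := characteristic_inv_le hΔm hr0
    have e5 : (diff c f)⁻¹ = fun z ↦ 1 / diff c f z := by ext z; simp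
    rw [e5] at h4
    simp only [characteristic, Pi.add_apply] at h4
    simp only [gap, err, Npair, T, characteristic, Pi.add_apply]
    simp only [N, m] at *
    linarith
  · have : gap r ≤ max 0 (gap r) := le_max_right _ _
    simp only [gap] at this ⊢
    linarith
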